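/- Let $\varepsilon,\gamma$ be nonzero real numbers and consider the two-dimensional viscoelastic equation $$u_{tt}-\varepsilon\,\partial_t\Delta u-\gamma\,\Delta u=f,\qquad \Delta=\partial_x^2+\partial_y^2,$$ with independent variables $x,y,t$ and dependent variables $u,f$. Write $L\alpha=\alpha_{tt}-\varepsilon\,\partial_t\Delta\alpha-\gamma\,\Delta\alpha$ and consider on $\mathbb R^5=\{(x,y,t,u,f)\}$ the vector fields $$X_1=\partial_x,\quad X_2=\partial_y,\quad X_3=\partial_t,\quad X_4=y\,\partial_x-x\,\partial_y,\quad X_5=u\,\partial_u+f\,\partial_f,\quad X_\alpha=\alpha\,\partial_u+(L\alpha)\,\partial_f,$$ where $\alpha=\alpha(x,y,t)$ is an arbitrary smooth function. 1. A smooth vector field $V$ on $\mathbb R^5$ satisfies the infinitesimal invariance condition $$\mathrm{Pr}^{(3)}V\,[u_{tt}-\varepsilon(u_{xxt}+u_{yyt})-\gamma(u_{xx}+u_{yy})-f]=0\quad\text{whenever}\quad u_{tt}-\varepsilon(u_{xxt}+u_{yyt})-\gamma(u_{xx}+u_{yy})-f=0$$ if and only if $V=\sum_{i=1}^5c_iX_i+X_\alpha$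 for some $c_1,\dots,c_5\in\mathbb R$ and some smooth $\alpha$. 2. Let $(\Phi_s)$ be a smooth local one-parameter group of transformations of $\mathbb R^5$ that is a group of point symmetries of the equation, that is: whenever some $\Phi_s$ carries the graph of a smooth solution $(u,f)$ on an open subset of $\mathbb R^3$ onto the graph of a pair of smooth functions on an open subset of $\mathbb R^3$, this pair is again a solution. Then its infinitesimal generator is $\sum_{i=1}^5c_iX_i+X_\alpha$ for some $c_1,\dots,c_5\in\mathbb R$ and some smooth $\alpha$. 3. Each of $X_1,\dots,X_5$, and $X_\alpha$ for every smooth $\alpha$, generates a global one-parameter group of point symmetries of the equation. 4. For smooth $\alpha$, the vector field $\alpha\,\partial_u$ satisfies the infinitesimal invariance condition if and only if $L\alpha=0$ (and then $X_\alpha=\alpha\,\partial_u$). 5. The commutators $[X_i,X_j]=X_iX_j-X_jX_i$, $1\le i,j\le5$, are $[X_1,X_4]=-X_2=-[X_4,X_1]$, $[X_2,X_4]=X_1=-[X_4,X_2]$, and all others vanish. -/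

import Mathlib

open scoped ContDiff

namespace Viscoelastic

/-- The space of independent variables; the coordinates `0, 1, 2` are `x, y, t`. -/
abbrev Base : Type := Fin 3 → ℝ

/-- The space of independent and dependent variables: `((x, y, t), u, f)`. -/
abbrev Total : Type := Base × ℝ × ℝ

/-- The partial derivative with respect to the `i`-th independent variable. -/
noncomputable def pd (i : Fin 3) (g : Base → ℝ) : Base → ℝ :=
  fun z => fderiv ℝ g z (Pi.single i 1)

/-- Iterated partial derivatives: `pds [i, j, k] g = ∂ᵢ ∂ⱼ ∂ₖ g`. -/
noncomputable def pds (J : List (Fin 3)) (g : Base → ℝ) : Base → ℝ :=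
  J.foldr pd g

/-- The Laplacian in the two space variables `x, y`. -/
noncomputable def laplacian (u : Base → ℝ) : Base → ℝ :=
  fun z => pd 0 (pd 0 u) z + pd 1 (pd 1 u) z

/-- The left hand side `u_tt - ε ∂_t (Δ u) - γ Δ u` of the viscoelastic equation. -/
noncomputable def viscoOp (ε γ : ℝ) (u : Base → ℝ) : Base → ℝ :=
  fun z => pd 2 (pd 2 u) z - ε * pd 2 (laplacian u) z - γ * laplacian u z

/-- `(u, f)` is a smooth solution of `u_tt - ε ∂_t (Δ u) - γ Δ u = f` on the set `Ω`
(used for open `Ω`). -/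
def IsSolutionOn (ε γ : ℝ) (u f : Base → ℝ) (Ω : Set Base) : Prop :=
  ContDiffOn ℝ ∞ u Ω ∧ ContDiffOn ℝ ∞ f Ω ∧ ∀ z ∈ Ω, viscoOp ε γ u z = f z

/-- The graph of the pair `(u, f)` over `Ω`. -/
def graphOver (u f : Base → ℝ) (Ω : Set Base) : Set Total :=
  (fun z => (z, u z, f z)) '' Ω

/-! ### Infinitesimal symmetries -/

/-- The characteristic `Q = φ₁ - ∑ᵢ ξⁱ uᵢ` of the vector field
`V = ∑ᵢ ξⁱ ∂_{xⁱ} + φ₁ ∂_u + φ₂ ∂_f`, evaluated along the pair of functions `(u, f)`. -/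
noncomputable def characteristicU (V : Total → Total) (u f : Base → ℝ) : Base → ℝ :=
  fun z => (V (z, u z, f z)).2.1 - ∑ i, (V (z, u z, f z)).1 i * pd i u z

/-- The coefficient `φ₁^J = D_J Q + ∑ᵢ ξⁱ u_{J,i}` of `∂/∂u_J` in the prolongation of `V`,
evaluated at the jet of `(u, f)` at `z`. Total derivatives evaluated along `(u, f)` are partial
derivatives of the composite function. -/
noncomputable def prolongU (V : Total → Total) (J : List (Fin 3)) (u f : Base → ℝ) (z : Base) : ℝ :=
  pds J (characteristicU V u f) z + ∑ i, (V (z, u z, f z)).1 i * pd i (pds J u) z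

/-- `Pr⁽³⁾V [u_tt - ε (u_xxt + u_yyt) - γ (u_xx + u_yy) - f]`, evaluated at the 3-jet of `(u, f)`
at `z`. -/
noncomputable def prolongEquation (ε γ : ℝ) (V : Total → Total) (u f : Base → ℝ) (z : Base) : ℝ :=
  prolongU V [2, 2] u f z
    - ε * (prolongU V [2, 0, 0] u f z + prolongU V [2, 1, 1] u f z)
    - γ * (prolongU V [0, 0] u f z + prolongU V [1, 1] u f z)
    - (V (z, u z, f z)).2.2

/-- The infinitesimal invariance condition: the third prolongation of `V` annihilates the equation
at every 3-jet that satisfies the equation. (Every 3-jet is the jet of a pair of smooth functions;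
the equation is only required at the point `z`.) -/
def IsInfinitesimalSymmetry (ε γ : ℝ) (V : Total → Total) : Prop :=
  ∀ u f : Base → ℝ, ContDiff ℝ ∞ u → ContDiff ℝ ∞ f →
    ∀ z : Base, viscoOp ε γ u z = f z → prolongEquation ε γ V u f z = 0

/-! ### One-parameter groups of point transformations -/

/-- A smooth local one-parameter group of transformations of the `(x, y, t, u, f)`-space. -/
structure LocalOneParameterGroup where
  /-- the open set of pairs (parameter, point) for which the transformation is defined -/
  dom : Set (ℝ × Total)
  /-- the transformations -/
  map : ℝ → Total → Total
  isOpen_dom : IsOpen dom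
  zero_mem : ∀ p, (0, p) ∈ dom
  smooth : ContDiffOn ℝ ∞ (fun q : ℝ × Total => map q.1 q.2) dom
  map_zero : ∀ p, map 0 p = p
  map_add : ∀ r s p, (r, p) ∈ dom → (s, map r p) ∈ dom → (s + r, p) ∈ dom →
    map s (map r p) = map (s + r) p
  neg_mem : ∀ s p, (s, p) ∈ dom → (-s, map s p) ∈ dom

/-- The infinitesimal generator, `V(p) = d/ds Φ_s(p)` at `s = 0`. -/
noncomputable def LocalOneParameterGroup.generator (Φ : LocalOneParameterGroup) : Total → Total :=
  fun p => deriv (fun s => Φ.map s p) 0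

/-- `Φ` is a group of point symmetries: whenever some `Φ_s` carries the graph of a solution onto
the graph of a pair of smooth functions, the latter is again a solution. -/
def LocalOneParameterGroup.IsSymmetryGroup (Φ : LocalOneParameterGroup) (ε γ : ℝ) : Prop :=
  ∀ (s : ℝ) (Ω Ω' : Set Base) (u f u' f' : Base → ℝ), IsOpen Ω → IsOpen Ω' →
    IsSolutionOn ε γ u f Ω → (∀ z ∈ Ω, (s, ((z, u z, f z) : Total)) ∈ Φ.dom) →
    ContDiffOn ℝ ∞ u' Ω' → ContDiffOn ℝ ∞ f' Ω' →
    Φ.map s '' graphOver u f Ω = graphOver u' f' Ω' →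
    IsSolutionOn ε γ u' f' Ω'

/-! ### The generators -/

/-- `X₁ = ∂_x` -/
def X₁ : Total → Total := fun _ => (![1, 0, 0], 0, 0)

/-- `X₂ = ∂_y` -/
def X₂ : Total → Total := fun _ => (![0, 1, 0], 0, 0)

/-- `X₃ = ∂_t` -/
def X₃ : Total → Total := fun _ => (![0, 0, 1], 0, 0)

/-- `X₄ = y ∂_x - x ∂_y` -/
def X₄ : Total → Total := fun p => (![p.1 1, -p.1 0, 0], 0, 0)

/-- `X₅ = u ∂_u + f ∂_f` -/
def X₅ : Total → Total := fun p => (0, p.2.1, p.2.2)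

/-- The five generators as a family. -/
def X : Fin 5 → Total → Total := ![X₁, X₂, X₃, X₄, X₅]

/-- The vector field `α ∂_u + β ∂_f`, for functions `α, β` of `(x, y, t)`. -/
def verticalField (α β : Base → ℝ) : Total → Total := fun p => (0, α p.1, β p.1)

/-- The vector field `X_α = α ∂_u + (α_tt - ε ∂_t (Δ α) - γ Δ α) ∂_f`; it is `α ∂_u` when `α`
solves the homogeneous equation. -/
noncomputable def Xα (ε γ : ℝ) (α : Base → ℝ) : Total → Total :=
  verticalField α (viscoOp ε γ α)

/-- The commutator table of `X₁, …, X₅`. -/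
def commutatorTable : Matrix (Fin 5) (Fin 5) (Total → Total) :=
  !![0,   0,   0, -X₂, 0;
     0,   0,   0,  X₁, 0;
     0,   0,   0,  0,  0;
     X₂, -X₁,  0,  0,  0;
     0,   0,   0,  0,  0]

end Viscoelastic

open Viscoelastic

open scoped ContDiff

namespace Viscoelastic

open Topology Filter

/-! ### Smooth functions on normed spaces -/

section General

variable {E F : Type*} [NormedAddCommGroup E] [NormedSpace ℝ E]
  [NormedAddCommGroup F] [NormedSpace ℝ F]

/-! Write `V = ξ·∂ + φ₁ ∂_u + φ₂ ∂_f`, let `Q` be its characteristic and `L` the viscoelastic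
operator. The prolonged equation is `L Q + ξ·∇(L u) - φ₂` (`prolongEquation_eq`). Since `f` enters
only undifferentiated, every smooth `u` gives the solution `(u, L u)`. Both infinitesimal symmetries
and symmetry groups therefore lead to one condition on arbitrary `u`, `IsInvariantAlongSolutions`,
and the classification starts from there.

Instead of expanding in jet coordinates, the condition is differentiated at `s = 0` along `u + s
exp(θ·z)`, for which `f` moves by `s σ(θ) exp(θ·z)` with `σ` the symbol of `L`. Dividing by the
exponential leaves a polynomial in `θ` that vanishes identically
(`IsInvariantAlongSolutions.linearised`). Its degree-six part is `ε²` times the characteristic of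
`∂V/∂f`, so `ξ` and `φ₁` do not depend on `f`. The other coefficients are the determining equations
(`determining_equations`).

These are identities along all `u`. Quadratic test functions with prescribed value, gradient and `L
u` (`jetFun`) turn them into equations for the partial derivatives of `ξ` and `φ₁`. They make `ξ` an
infinitesimal rigid motion of the plane plus a time translation, and `φ₁` affine in `u` with
constant slope (`components`); `φ₂` is then read off from the invariance condition itself.
Conversely, `viscoOp_characteristicU` computes the left side for every such `ξ` and `φ₁`.

For a symmetry group, the inverse function theorem applied jointly in the parameter and the base
point writes the moved graphs as graphs of a smooth family of solutions. The parameter derivative of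
that family is the characteristic, and it commutes with `L`. The listed fields have explicit flows,
built from rigid motions, scalings and superpositions, all of which preserve solutions. -/

lemma contDiff_fderiv_apply_const {g : E → F} (hg : ContDiff ℝ ∞ g) (v : E) :
    ContDiff ℝ ∞ (fun x => fderiv ℝ g x v) :=
  (hg.fderiv_right (m := ∞) (by simp)).clm_apply contDiff_const

lemma differentiable_of_smooth {g : E → F} (hg : ContDiff ℝ ∞ g) : Differentiable ℝ g :=
  hg.differentiable (by simp)

lemma fderiv_fderiv_apply_comm {g : E → F} (hg : ContDiff ℝ ∞ g) (v w x : E) :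
    fderiv ℝ (fun y => fderiv ℝ g y v) x w = fderiv ℝ (fun y => fderiv ℝ g y w) x v := by
  have hd : DifferentiableAt ℝ (fderiv ℝ g) x :=
    (hg.fderiv_right (m := ∞) (by simp)).differentiable (by simp) x
  have hs : IsSymmSndFDerivAt ℝ g x :=
    hg.contDiffAt.isSymmSndFDerivAt (by simpa using ENat.LEInfty.out)
  rw [fderiv_clm_apply hd (differentiableAt_const v),
    fderiv_clm_apply hd (differentiableAt_const w)]
  simpa using hs.eq w v

/-- A smooth germ extends to a globally smooth function. -/
lemma exists_contDiff_eventuallyEq [FiniteDimensional ℝ E] {g : E → ℝ} {U : Set E}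
    (hU : IsOpen U) (hg : ContDiffOn ℝ ∞ g U) {x : E} (hx : x ∈ U) :
    ∃ g' : E → ℝ, ContDiff ℝ ∞ g' ∧ g' =ᶠ[𝓝 x] g := by
  obtain ⟨r, hr, hrU⟩ := Metric.isOpen_iff.1 hU x hx
  -- The outer radius is less than `r`, so the bump vanishes near every point outside `U`, and there
  -- the product is locally zero whatever `g` is.
  let b : ContDiffBump x := ⟨r / 4, r / 2, by positivity, by linarith⟩
  refine ⟨fun y => b y * g y, ?_, ?_⟩
  · rw [contDiff_iff_contDiffAt]
    intro y
    by_cases hy : y ∈ U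
    · exact b.contDiff.contDiffAt.mul (hg.contDiffAt (hU.mem_nhds hy))
    · have hy' : y ∈ (Metric.closedBall x (r / 2))ᶜ := fun h =>
        hy (hrU (Metric.closedBall_subset_ball (by linarith) h))
      have : (fun y => b y * g y) =ᶠ[𝓝 y] fun _ => 0 := by
        filter_upwards [Metric.isClosed_closedBall.isOpen_compl.mem_nhds hy'] with w hw
        have : b w = 0 := b.zero_of_le_dist (by
          have : ¬ dist w x ≤ r / 2 := hw
          exact (not_le.1 this).le)
        simp [this]
      exact contDiffAt_const.congr_of_eventuallyEq this
  · filter_upwards [b.eventuallyEq_one] with y hy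
    simp [hy]

end General

/-! ### Calculus of partial derivatives -/

@[fun_prop]
lemma contDiff_pd {g : Base → ℝ} (hg : ContDiff ℝ ∞ g) (i : Fin 3) : ContDiff ℝ ∞ (pd i g) :=
  contDiff_fderiv_apply_const hg _

lemma pd_congr {g g' : Base → ℝ} {z : Base} (h : g =ᶠ[𝓝 z] g') (i : Fin 3) :
    pd i g =ᶠ[𝓝 z] pd i g' := by
  filter_upwards [h.fderiv (𝕜 := ℝ)] with y hy
  simp [pd, hy]

lemma viscoOp_congr (ε γ : ℝ) {g g' : Base → ℝ} {z : Base} (h : g =ᶠ[𝓝 z] g') :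
    viscoOp ε γ g =ᶠ[𝓝 z] viscoOp ε γ g' := by
  have hL : laplacian g =ᶠ[𝓝 z] laplacian g' :=
    (pd_congr (pd_congr h 0) 0).add (pd_congr (pd_congr h 1) 1)
  filter_upwards [pd_congr (pd_congr h 2) 2, pd_congr hL 2, hL] with y h1 h2 h3
  simp [viscoOp, h1, h2, h3]

lemma pd_comm {g : Base → ℝ} (hg : ContDiff ℝ ∞ g) (i j : Fin 3) :
    pd i (pd j g) = pd j (pd i g) :=
  funext fun _ => fderiv_fderiv_apply_comm hg _ _ _

lemma pd_add {g h : Base → ℝ} (hg : ContDiff ℝ ∞ g) (hh : ContDiff ℝ ∞ h) (i : Fin 3) :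
    pd i (fun z => g z + h z) = fun z => pd i g z + pd i h z := by
  funext z
  simp [pd, fderiv_fun_add (differentiable_of_smooth hg z) (differentiable_of_smooth hh z)]

lemma pd_sub {g h : Base → ℝ} (hg : ContDiff ℝ ∞ g) (hh : ContDiff ℝ ∞ h) (i : Fin 3) :
    pd i (fun z => g z - h z) = fun z => pd i g z - pd i h z := by
  funext z
  simp [pd, fderiv_fun_sub (differentiable_of_smooth hg z) (differentiable_of_smooth hh z)]

lemma pd_mul {g h : Base → ℝ} (hg : ContDiff ℝ ∞ g) (hh : ContDiff ℝ ∞ h) (i : Fin 3) :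
    pd i (fun z => g z * h z) = fun z => pd i g z * h z + g z * pd i h z := by
  funext z
  simp [pd, fderiv_fun_mul (differentiable_of_smooth hg z) (differentiable_of_smooth hh z)]
  ring

lemma pd_const (c : ℝ) (i : Fin 3) : pd i (fun _ => c) = fun _ => 0 := by
  funext z; simp [pd]

lemma pd_const_mul {g : Base → ℝ} (hg : ContDiff ℝ ∞ g) (c : ℝ) (i : Fin 3) :
    pd i (fun z => c * g z) = fun z => c * pd i g z := by
  rw [pd_mul contDiff_const hg, pd_const]; simp

lemma pd_coord (i j : Fin 3) : pd i (fun z => z j) = fun _ => if i = j then 1 else 0 := by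
  funext z
  have : HasFDerivAt (fun z : Base => z j) (ContinuousLinearMap.proj j) z :=
    (ContinuousLinearMap.proj (R := ℝ) (φ := fun _ : Fin 3 => ℝ) j).hasFDerivAt
  simp [pd, this.fderiv, Pi.single_apply, eq_comm]

@[fun_prop]
lemma contDiff_laplacian {g : Base → ℝ} (hg : ContDiff ℝ ∞ g) : ContDiff ℝ ∞ (laplacian g) :=
  (contDiff_pd (contDiff_pd hg 0) 0).add (contDiff_pd (contDiff_pd hg 1) 1)

@[fun_prop]
lemma contDiff_viscoOp (ε γ : ℝ) {g : Base → ℝ} (hg : ContDiff ℝ ∞ g) :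
    ContDiff ℝ ∞ (viscoOp ε γ g) :=
  ((contDiff_pd (contDiff_pd hg 2) 2).sub
    (contDiff_const.mul (contDiff_pd (contDiff_laplacian hg) 2))).sub
    (contDiff_const.mul (contDiff_laplacian hg))

/-- The viscoelastic operator as a combination of iterated partial derivatives. -/
lemma viscoOp_eq (ε γ : ℝ) {g : Base → ℝ} (hg : ContDiff ℝ ∞ g) :
    viscoOp ε γ g = fun z => pd 2 (pd 2 g) z
      - ε * (pd 2 (pd 0 (pd 0 g)) z + pd 2 (pd 1 (pd 1 g)) z)
      - γ * (pd 0 (pd 0 g) z + pd 1 (pd 1 g) z) := by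
  funext z
  have : pd 2 (laplacian g) = fun z => pd 2 (pd 0 (pd 0 g)) z + pd 2 (pd 1 (pd 1 g)) z :=
    pd_add (contDiff_pd (contDiff_pd hg 0) 0) (contDiff_pd (contDiff_pd hg 1) 1) 2
  simp [viscoOp, this, laplacian]

lemma viscoOp_add (ε γ : ℝ) {g h : Base → ℝ} (hg : ContDiff ℝ ∞ g) (hh : ContDiff ℝ ∞ h) :
    viscoOp ε γ (fun z => g z + h z) = fun z => viscoOp ε γ g z + viscoOp ε γ h z := by
  rw [viscoOp_eq ε γ hg, viscoOp_eq ε γ hh, viscoOp_eq ε γ (hg.add hh)]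
  simp (disch := fun_prop) only [pd_add]
  funext z; ring

lemma viscoOp_const_mul (ε γ c : ℝ) {g : Base → ℝ} (hg : ContDiff ℝ ∞ g) :
    viscoOp ε γ (fun z => c * g z) = fun z => c * viscoOp ε γ g z := by
  rw [viscoOp_eq ε γ hg, viscoOp_eq ε γ (contDiff_const.mul hg)]
  simp (disch := fun_prop) only [pd_const_mul]
  funext z; ring

/-! ### Dependence on a parameter -/

lemma fderiv_slice {g : ℝ × Base → ℝ} (hg : Differentiable ℝ g) (s : ℝ) (z v : Base) :
    fderiv ℝ (fun w => g (s, w)) z v = fderiv ℝ g (s, z) (0, v) := by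
  have h : HasFDerivAt (fun w : Base => (s, w)) (ContinuousLinearMap.inr ℝ ℝ Base) z :=
    hasFDerivAt_prodMk_right s z
  have := (hg (s, z)).hasFDerivAt.comp z h
  rw [show (fun w => g (s, w)) = g ∘ fun w => (s, w) from rfl, this.fderiv]
  simp

/-- Partial derivative in the base of a function depending on a parameter. -/
noncomputable def paramPd (i : Fin 3) (g : ℝ × Base → ℝ) : ℝ × Base → ℝ :=
  fun q => fderiv ℝ g q (0, Pi.single i 1)

@[fun_prop]
lemma contDiff_paramPd {g : ℝ × Base → ℝ} (hg : ContDiff ℝ ∞ g) (i : Fin 3) :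
    ContDiff ℝ ∞ (paramPd i g) := contDiff_fderiv_apply_const hg _

lemma pd_slice {g : ℝ × Base → ℝ} (hg : ContDiff ℝ ∞ g) (i : Fin 3) (s : ℝ) :
    pd i (fun z => g (s, z)) = fun z => paramPd i g (s, z) :=
  funext fun _ => fderiv_slice (differentiable_of_smooth hg) _ _ _

lemma contDiff_slice {g : ℝ × Base → ℝ} (hg : ContDiff ℝ ∞ g) (s : ℝ) :
    ContDiff ℝ ∞ (fun z => g (s, z)) := hg.comp (contDiff_const.prodMk contDiff_id)

lemma hasDerivAt_slice {g : ℝ × Base → ℝ} (hg : ContDiff ℝ ∞ g) (s : ℝ) (z : Base) :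
    HasDerivAt (fun r => g (r, z)) (fderiv ℝ g (s, z) (1, 0)) s := by
  have h : HasDerivAt (fun r : ℝ => (r, z)) ((1 : ℝ), (0 : Base)) s :=
    (hasDerivAt_id _).prodMk (hasDerivAt_const _ _)
  have h' := (differentiable_of_smooth hg (s, z)).hasFDerivAt
  exact h'.comp_hasDerivAt s h

/-- The viscoelastic operator commutes with differentiation in a parameter. -/
lemma hasDerivAt_viscoOp_slice (ε γ : ℝ) {g : ℝ × Base → ℝ} (hg : ContDiff ℝ ∞ g) (z : Base) :
    HasDerivAt (fun s => viscoOp ε γ (fun w => g (s, w)) z)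
      (viscoOp ε γ (fun w => fderiv ℝ g (0, w) (1, 0)) z) 0 := by
  let dS : (ℝ × Base → ℝ) → ℝ × Base → ℝ := fun g q => fderiv ℝ g q (1, 0)
  have hdS : ∀ {g}, ContDiff ℝ ∞ g → ContDiff ℝ ∞ (dS g) := fun hg =>
    contDiff_fderiv_apply_const hg _
  have hcomm : ∀ {g}, ContDiff ℝ ∞ g → ∀ i, dS (paramPd i g) = paramPd i (dS g) :=
    fun hg i => funext fun q => fderiv_fderiv_apply_comm hg _ _ _
  have hder : ∀ {g}, ContDiff ℝ ∞ g → HasDerivAt (fun s => g (s, z)) (dS g (0, z)) 0 :=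
    fun hg => hasDerivAt_slice hg 0 z
  have hP : ∀ {g}, ContDiff ℝ ∞ g → ∀ i, ContDiff ℝ ∞ (paramPd i g) := contDiff_paramPd
  have e1 : ∀ s, viscoOp ε γ (fun w => g (s, w)) z =
      paramPd 2 (paramPd 2 g) (s, z)
      - ε * (paramPd 2 (paramPd 0 (paramPd 0 g)) (s, z) +
          paramPd 2 (paramPd 1 (paramPd 1 g)) (s, z))
      - γ * (paramPd 0 (paramPd 0 g) (s, z) + paramPd 1 (paramPd 1 g) (s, z)) := by
    intro s
    rw [viscoOp_eq ε γ (contDiff_slice hg s)]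
    simp (disch := fun_prop) only [pd_slice]
  have e2 : viscoOp ε γ (fun w => fderiv ℝ g (0, w) (1, 0)) z =
      paramPd 2 (paramPd 2 (dS g)) (0, z)
      - ε * (paramPd 2 (paramPd 0 (paramPd 0 (dS g))) (0, z) +
          paramPd 2 (paramPd 1 (paramPd 1 (dS g))) (0, z))
      - γ * (paramPd 0 (paramPd 0 (dS g)) (0, z) + paramPd 1 (paramPd 1 (dS g)) (0, z)) := by
    change viscoOp ε γ (fun w => dS g (0, w)) z = _
    have hd := hdS hg
    rw [viscoOp_eq ε γ (contDiff_slice hd 0)]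
    simp (disch := fun_prop) only [pd_slice]
  rw [e2, funext e1]
  -- The parameter derivative is moved outside all base derivatives, so that each term is the
  -- derivative of the corresponding term of `e1`.
  simp only [← hcomm hg, ← hcomm (hP hg _), ← hcomm (hP (hP hg _) _)]
  exact ((hder (hP (hP hg 2) 2)).sub
    (((hder (hP (hP (hP hg 0) 0) 2)).add (hder (hP (hP (hP hg 1) 1) 2))).const_mul ε)).sub
    (((hder (hP (hP hg 0) 0)).add (hder (hP (hP hg 1) 1))).const_mul γ)

/-! ### Prolongation through the characteristic -/

lemma contDiff_characteristicU {V : Total → Total} (hV : ContDiff ℝ ∞ V) {u f : Base → ℝ}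
    (hu : ContDiff ℝ ∞ u) (hf : ContDiff ℝ ∞ f) : ContDiff ℝ ∞ (characteristicU V u f) := by
  unfold characteristicU
  fun_prop

/-- The prolongation acts on the equation through the characteristic. -/
lemma prolongEquation_eq (ε γ : ℝ) {V : Total → Total} (hV : ContDiff ℝ ∞ V) {u f : Base → ℝ}
    (hu : ContDiff ℝ ∞ u) (hf : ContDiff ℝ ∞ f) (z : Base) :
    prolongEquation ε γ V u f z = viscoOp ε γ (characteristicU V u f) z
      + ∑ i, (V (z, u z, f z)).1 i * pd i (viscoOp ε γ u) z - (V (z, u z, f z)).2.2 := by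
  rw [viscoOp_eq ε γ (contDiff_characteristicU hV hu hf), viscoOp_eq ε γ hu]
  simp (disch := fun_prop) only [pd_sub, pd_add, pd_const_mul]
  simp only [prolongEquation, prolongU, pds, List.foldr, Fin.sum_univ_three]
  ring

/-- The invariance condition holds for the components `ξ`, `φ₁` of a combination of generators, up
to the component of `∂_f`. -/
lemma viscoOp_characteristicU (ε γ : ℝ) (c : Fin 5 → ℝ) {α u f : Base → ℝ}
    {V : Total → Total} (hα : ContDiff ℝ ∞ α) (hu : ContDiff ℝ ∞ u)
    (hξ : ∀ p, (V p).1 = ![c 0 + c 3 * p.1 1, c 1 - c 3 * p.1 0, c 2])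
    (hφ : ∀ p, (V p).2.1 = c 4 * p.2.1 + α p.1) (z : Base) :
    viscoOp ε γ (characteristicU V u f) z + ∑ i, (V (z, u z, f z)).1 i * pd i (viscoOp ε γ u) z
      = c 4 * viscoOp ε γ u z + viscoOp ε γ α z := by
  have hQ : characteristicU V u f = fun z => c 4 * u z + α z - ((c 0 + c 3 * z 1) * pd 0 u z
      + (c 1 - c 3 * z 0) * pd 1 u z + c 2 * pd 2 u z) := by
    funext z
    simp [characteristicU, Fin.sum_univ_three, hξ, hφ]
  rw [hQ, viscoOp_eq _ _ (by fun_prop), viscoOp_eq _ _ hu, viscoOp_eq _ _ hα]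
  simp (disch := fun_prop) only [pd_sub, pd_add, pd_const_mul, pd_mul, pd_const, pd_coord]
  simp [Fin.sum_univ_three, hξ]
  -- Mixed partials are brought to a common order. The second-derivative terms produced by the
  -- rotation then cancel between the `x` and `y` parts of the Laplacian.
  simp (disch := fun_prop) only [pd_comm _ 2, pd_comm _ 1 0]
  ring

/-! ### Linearisation along exponentials -/

/-- The invariance condition along solutions `(u, L u)`. -/
def IsInvariantAlongSolutions (ε γ : ℝ) (V : Total → Total) : Prop :=
  ∀ u : Base → ℝ, ContDiff ℝ ∞ u → ∀ z : Base,
    viscoOp ε γ (characteristicU V u (viscoOp ε γ u)) z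
      + ∑ i, (V (z, u z, viscoOp ε γ u z)).1 i * pd i (viscoOp ε γ u) z
      - (V (z, u z, viscoOp ε γ u z)).2.2 = 0

/-- Choosing `f = L u` satisfies the constraint at every point and removes `f` as an independent
unknown. -/
lemma IsInfinitesimalSymmetry.isInvariantAlongSolutions {ε γ : ℝ} {V : Total → Total}
    (hV : ContDiff ℝ ∞ V) (h : IsInfinitesimalSymmetry ε γ V) :
    IsInvariantAlongSolutions ε γ V := fun u hu z => by
  have hf := contDiff_viscoOp ε γ hu
  rw [← prolongEquation_eq ε γ hV hu hf]
  exact h u _ hu hf z rfl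

/-- The exponential `exp (θ · z)`. -/
noncomputable def expWave (θ z : Base) : ℝ := Real.exp (∑ i, θ i * z i)

@[fun_prop]
lemma contDiff_expWave (θ : Base) : ContDiff ℝ ∞ (expWave θ) := by
  unfold expWave
  fun_prop

lemma expWave_ne_zero (θ z : Base) : expWave θ z ≠ 0 := (Real.exp_pos _).ne'

lemma pd_expWave (θ : Base) (i : Fin 3) : pd i (expWave θ) = fun z => θ i * expWave θ z := by
  funext z
  have h : HasFDerivAt (fun z : Base => ∑ i, θ i * z i)
      (∑ i, θ i • ContinuousLinearMap.proj (R := ℝ) (φ := fun _ : Fin 3 => ℝ) i) z :=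
    HasFDerivAt.fun_sum fun i _ =>
      ((ContinuousLinearMap.proj (R := ℝ) (φ := fun _ : Fin 3 => ℝ) i).hasFDerivAt).const_mul (θ i)
  have h2 : HasFDerivAt (expWave θ) _ z := h.exp
  rw [pd, h2.fderiv]
  simp [expWave, Pi.single_apply, mul_comm]

/-- The symbol of the viscoelastic operator. -/
def viscoSymbol (ε γ : ℝ) (θ : Base) : ℝ :=
  θ 2 ^ 2 - ε * (θ 2 * (θ 0 ^ 2 + θ 1 ^ 2)) - γ * (θ 0 ^ 2 + θ 1 ^ 2)

lemma viscoOp_expWave (ε γ : ℝ) (θ : Base) :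
    viscoOp ε γ (expWave θ) = fun z => viscoSymbol ε γ θ * expWave θ z := by
  rw [viscoOp_eq _ _ (by fun_prop)]
  simp (disch := fun_prop) only [pd_expWave, pd_const_mul]
  funext z
  simp only [viscoSymbol]
  ring

/-- The conjugate `exp (-θ · z) L (exp (θ · z) a)` of the viscoelastic operator. -/
noncomputable def conjViscoOp (ε γ : ℝ) (θ : Base) (a : Base → ℝ) (z : Base) : ℝ :=
  pd 2 (pd 2 a) z + 2 * θ 2 * pd 2 a z + θ 2 ^ 2 * a z
  - ε * (pd 2 (pd 0 (pd 0 a)) z + 2 * θ 0 * pd 2 (pd 0 a) z + θ 0 ^ 2 * pd 2 a z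
      + θ 2 * pd 0 (pd 0 a) z + 2 * θ 2 * θ 0 * pd 0 a z + θ 2 * θ 0 ^ 2 * a z
      + (pd 2 (pd 1 (pd 1 a)) z + 2 * θ 1 * pd 2 (pd 1 a) z + θ 1 ^ 2 * pd 2 a z
      + θ 2 * pd 1 (pd 1 a) z + 2 * θ 2 * θ 1 * pd 1 a z + θ 2 * θ 1 ^ 2 * a z))
  - γ * (pd 0 (pd 0 a) z + 2 * θ 0 * pd 0 a z + θ 0 ^ 2 * a z
      + (pd 1 (pd 1 a) z + 2 * θ 1 * pd 1 a z + θ 1 ^ 2 * a z))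

lemma viscoOp_mul_expWave (ε γ : ℝ) (θ : Base) {a : Base → ℝ} (ha : ContDiff ℝ ∞ a) (z : Base) :
    viscoOp ε γ (fun z => a z * expWave θ z) z = conjViscoOp ε γ θ a z * expWave θ z := by
  rw [viscoOp_eq _ _ (by fun_prop)]
  simp (disch := fun_prop) only [pd_expWave, pd_const_mul, pd_mul, pd_add]
  simp only [conjViscoOp]
  ring

/-- The derivative of a vector field in the direction of `u`. -/
noncomputable def derivU (V : Total → Total) : Total → Total := fun p => fderiv ℝ V p (0, 1, 0)

/-- The derivative of a vector field in the direction of `f`. -/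
noncomputable def derivF (V : Total → Total) : Total → Total := fun p => fderiv ℝ V p (0, 0, 1)

@[fun_prop]
lemma contDiff_derivU {V : Total → Total} (hV : ContDiff ℝ ∞ V) : ContDiff ℝ ∞ (derivU V) :=
  contDiff_fderiv_apply_const hV _

@[fun_prop]
lemma contDiff_derivF {V : Total → Total} (hV : ContDiff ℝ ∞ V) : ContDiff ℝ ∞ (derivF V) :=
  contDiff_fderiv_apply_const hV _

/-- The linearised invariance condition, tested on exponentials. -/
lemma IsInvariantAlongSolutions.linearised {ε γ : ℝ} {V : Total → Total} (hV : ContDiff ℝ ∞ V)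
    (h : IsInvariantAlongSolutions ε γ V) {u f : Base → ℝ} (hu : ContDiff ℝ ∞ u)
    (hf : f = viscoOp ε γ u) (z : Base) :
    ∃ e₀ e₁ : ℝ, ∀ θ : Base,
      conjViscoOp ε γ θ (fun w => characteristicU (derivU V) u f w
          + viscoSymbol ε γ θ * characteristicU (derivF V) u f w
          - ∑ i, θ i * (V (w, u w, f w)).1 i) z
        + viscoSymbol ε γ θ * ∑ i, θ i * (V (z, u z, f z)).1 i
        + e₀ + viscoSymbol ε γ θ * e₁ = 0 := by
  have hfs : ContDiff ℝ ∞ f := hf ▸ contDiff_viscoOp ε γ hu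
  -- These collect the variation of `ξ·∇f - φ₂` through the `u` and `f` arguments of `V`. They do
  -- not depend on `θ`, which is all that the comparison of coefficients needs.
  refine ⟨∑ i, (derivU V (z, u z, f z)).1 i * pd i f z - (derivU V (z, u z, f z)).2.2,
    ∑ i, (derivF V (z, u z, f z)).1 i * pd i f z - (derivF V (z, u z, f z)).2.2, fun θ => ?_⟩
  set σ := viscoSymbol ε γ θ with hσ
  let P : ℝ → Base → Total := fun s w =>
    V (w, u w + s * expWave θ w, f w + s * (σ * expWave θ w))
  let g : ℝ × Base → ℝ := fun q => (P q.1 q.2).2.1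
    - ∑ i, (P q.1 q.2).1 i * (pd i u q.2 + q.1 * (θ i * expWave θ q.2))
  have hg : ContDiff ℝ ∞ g := by
    simp only [g, P]
    fun_prop
  have hP : ∀ w, HasDerivAt (fun s => P s w)
      (expWave θ w • (derivU V (w, u w, f w) + σ • derivF V (w, u w, f w))) 0 := by
    intro w
    have h1 : HasDerivAt (fun s : ℝ =>
        ((w, u w + s * expWave θ w, f w + s * (σ * expWave θ w)) : Total))
        ((0, 1 * expWave θ w, 1 * (σ * expWave θ w)) : Total) 0 :=
      (hasDerivAt_const _ _).prodMk ((((hasDerivAt_id (0 : ℝ)).mul_const _).const_add _).prodMk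
        (((hasDerivAt_id (0 : ℝ)).mul_const _).const_add _))
    have h2 := ((differentiable_of_smooth hV _).hasFDerivAt).comp_hasDerivAt (0 : ℝ) h1
    have e : ((0, 1 * expWave θ w, 1 * (σ * expWave θ w)) : Total) =
        expWave θ w • (((0, 1, 0) : Total) + σ • ((0, 0, 1) : Total)) := by
      simp [mul_comm]
    rw [e, map_smul, map_add, map_smul] at h2
    simpa [derivU, derivF, P, Function.comp_def] using h2
  have hPl : ∀ w (l : Total →L[ℝ] ℝ), HasDerivAt (fun s => l (P s w))
      (expWave θ w * (l (derivU V (w, u w, f w)) + σ * l (derivF V (w, u w, f w)))) 0 :=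
    fun w l => by
      have := l.hasFDerivAt.comp_hasDerivAt (0 : ℝ) (hP w)
      rw [map_smul, map_add, map_smul] at this
      exact this
  have hP1 : ∀ w i, HasDerivAt (fun s => (P s w).1 i)
      (expWave θ w * ((derivU V (w, u w, f w)).1 i + σ * (derivF V (w, u w, f w)).1 i)) 0 :=
    fun w i => hPl w ((ContinuousLinearMap.proj (R := ℝ) (φ := fun _ : Fin 3 => ℝ) i).comp
      (ContinuousLinearMap.fst ℝ Base (ℝ × ℝ)))
  have hP2 : ∀ w, HasDerivAt (fun s => (P s w).2.1)
      (expWave θ w * ((derivU V (w, u w, f w)).2.1 + σ * (derivF V (w, u w, f w)).2.1)) 0 :=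
    fun w => hPl w ((ContinuousLinearMap.fst ℝ ℝ ℝ).comp (ContinuousLinearMap.snd ℝ Base (ℝ × ℝ)))
  have hP3 : HasDerivAt (fun s => (P s z).2.2)
      (expWave θ z * ((derivU V (z, u z, f z)).2.2 + σ * (derivF V (z, u z, f z)).2.2)) 0 :=
    hPl z ((ContinuousLinearMap.snd ℝ ℝ ℝ).comp (ContinuousLinearMap.snd ℝ Base (ℝ × ℝ)))
  have hP0 : ∀ w, P 0 w = V (w, u w, f w) := fun w => by simp [P]
  have hlin : ∀ w i (F : Base → ℝ) (c : ℝ), HasDerivAt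
      (fun s => (P s w).1 i * (F w + s * c))
      (expWave θ w * ((derivU V (w, u w, f w)).1 i + σ * (derivF V (w, u w, f w)).1 i) * F w
        + (V (w, u w, f w)).1 i * c) 0 := fun w i F c => by
    have := (hP1 w i).fun_mul (((hasDerivAt_id (0 : ℝ)).mul_const c).const_add (F w))
    simpa [hP0] using this
  have hgd : (fun w => fderiv ℝ g (0, w) (1, 0)) = fun w => (characteristicU (derivU V) u f w
      + σ * characteristicU (derivF V) u f w - ∑ i, θ i * (V (w, u w, f w)).1 i) * expWave θ w := by
    funext w
    have h2 := hasDerivAt_slice hg 0 w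
    have h3 : HasDerivAt (fun s => g (s, w)) _ 0 :=
      (hP2 w).sub (HasDerivAt.fun_sum (u := Finset.univ)
        fun i _ => hlin w i (pd i u) (θ i * expWave θ w))
    rw [h2.unique h3]
    simp only [characteristicU, Fin.sum_univ_three]
    ring
  -- The perturbed pair is again of the form `(u, L u)`, because the exponential is an eigenfunction
  -- of `L`. The invariance expression is thus zero for all `s`, and so is its derivative.
  have hN : ∀ s : ℝ, viscoOp ε γ (fun w => g (s, w)) z
      + ∑ i, (P s z).1 i * (pd i f z + s * (σ * (θ i * expWave θ z))) - (P s z).2.2 = 0 := by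
    intro s
    have hus : ContDiff ℝ ∞ (fun w => u w + s * expWave θ w) := by fun_prop
    have hLs : viscoOp ε γ (fun w => u w + s * expWave θ w) =
        fun w => f w + s * (σ * expWave θ w) := by
      rw [viscoOp_add _ _ hu (by fun_prop), viscoOp_const_mul _ _ _ (by fun_prop),
        viscoOp_expWave, hf]
    have := h _ hus z
    rw [hLs] at this
    have hc : characteristicU V (fun w => u w + s * expWave θ w)
        (fun w => f w + s * (σ * expWave θ w)) = fun w => g (s, w) := by
      funext w
      simp (disch := fun_prop) only [characteristicU, pd_add, pd_const_mul, pd_expWave, g, P]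
    rw [hc] at this
    simpa (disch := fun_prop) only [pd_add, pd_const_mul, pd_expWave] using this
  have hD := ((hasDerivAt_viscoOp_slice ε γ hg z).add (HasDerivAt.fun_sum (u := Finset.univ)
    fun i _ => hlin z i (pd i f) (σ * (θ i * expWave θ z)))).sub hP3
  have h0 := hD.unique ((hasDerivAt_const (0 : ℝ) (0 : ℝ)).congr_of_eventuallyEq
    (Filter.Eventually.of_forall hN))
  have hA := contDiff_characteristicU (contDiff_derivU hV) hu hfs
  have hB := contDiff_characteristicU (contDiff_derivF hV) hu hfs
  rw [hgd, viscoOp_mul_expWave _ _ _ (by fun_prop)] at h0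
  refine (mul_eq_zero.1 (?_ : _ * expWave θ z = 0)).resolve_right (expWave_ne_zero θ z)
  rw [← h0]
  simp only [Fin.sum_univ_three]
  ring

/-! ### Extraction of the determining equations -/

/-- The polynomial in `θ` given by the linearised invariance condition, for coefficient functions
`A`, `B`, `X` along a solution. -/
noncomputable def linearisedSymbol (ε γ : ℝ) (A B : Base → ℝ) (X : Fin 3 → Base → ℝ) (e₀ e₁ : ℝ)
    (z θ : Base) : ℝ :=
  conjViscoOp ε γ θ A z + viscoSymbol ε γ θ * conjViscoOp ε γ θ B z
    - ∑ i, θ i * conjViscoOp ε γ θ (X i) z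
    + viscoSymbol ε γ θ * ∑ i, θ i * X i z + e₀ + viscoSymbol ε γ θ * e₁

/-- Linearity over constants: `θ` and the symbol do not depend on the base point, so they pass
through the operator and all dependence on `θ` becomes explicitly polynomial. -/
lemma conjViscoOp_combination (ε γ c : ℝ) (θ : Base) {A B : Base → ℝ} {X : Fin 3 → Base → ℝ}
    (hA : ContDiff ℝ ∞ A) (hB : ContDiff ℝ ∞ B) (hX : ∀ i, ContDiff ℝ ∞ (X i)) (z : Base) :
    conjViscoOp ε γ θ (fun w => A w + c * B w - ∑ i, θ i * X i w) z =
      conjViscoOp ε γ θ A z + c * conjViscoOp ε γ θ B z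
        - ∑ i, θ i * conjViscoOp ε γ θ (X i) z := by
  simp only [Fin.sum_univ_three]
  have h0 := hX 0
  have h1 := hX 1
  have h2 := hX 2
  simp (disch := fun_prop) only [conjViscoOp, pd_add, pd_sub, pd_const_mul]
  ring

/-- Only the symbol times the conjugated operator on `B` reaches degree six in `θ`; the terms
without `B` have degree at most four. On the line `θ = (a, 0, a)` the coefficient of `a⁶` is `ε² B`.
-/
lemma eq_zero_of_linearisedSymbol {ε γ : ℝ} (hε : ε ≠ 0) {A B : Base → ℝ} {X : Fin 3 → Base → ℝ}
    {e₀ e₁ : ℝ} {z : Base} (h : ∀ θ, linearisedSymbol ε γ A B X e₀ e₁ z θ = 0) : B z = 0 := by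
  have H : ∀ a : ℝ, _ := fun a => h ![a, 0, a]
  simp only [linearisedSymbol, conjViscoOp, viscoSymbol, Fin.sum_univ_three, Matrix.cons_val_zero,
    Matrix.cons_val_one, Matrix.cons_val] at H
  -- The sixth central difference equals `6! = 720` times the leading coefficient and kills all
  -- lower powers.
  have : 720 * ε ^ 2 * B z = 0 := by
    linear_combination H 3 - 6 * H 2 + 15 * H 1 - 20 * H 0 + 15 * H (-1) - 6 * H (-2) + H (-3)
  simpa [hε] using this

/-- Comparison of coefficients in `θ`. The undifferentiated `X` terms cancel, which leaves degree at
most three; `A` and `e₁` both multiply the symbol and so appear as `A + e₁`. In order, the monomials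
are `θ₀³, θ₁³, θ₀θ₂², θ₁θ₂², θ₀θ₁θ₂`, then `θ₀²θ₂, θ₁²θ₂, θ₂²`, then `θ₀θ₂, θ₁θ₂`, then `θ₀²` and
`θ₂`. -/
lemma determining_equations {ε γ : ℝ} (hε : ε ≠ 0) {A : Base → ℝ} {X : Fin 3 → Base → ℝ}
    {e₀ e₁ : ℝ} {z : Base} (h : ∀ θ, linearisedSymbol ε γ A (fun _ => 0) X e₀ e₁ z θ = 0) :
    (pd 2 (X 0) z = 0 ∧ pd 2 (X 1) z = 0 ∧ pd 0 (X 2) z = 0 ∧ pd 1 (X 2) z = 0 ∧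
      pd 1 (X 0) z + pd 0 (X 1) z = 0) ∧
    (A z + e₁ = 2 * pd 0 (X 0) z + pd 2 (X 2) z ∧ A z + e₁ = 2 * pd 1 (X 1) z + pd 2 (X 2) z ∧
      A z + e₁ = 2 * pd 2 (X 2) z - ε * (pd 0 (pd 0 (X 2)) z + pd 1 (pd 1 (X 2)) z)) ∧
    (2 * ε * pd 0 A z = ε * (pd 0 (pd 0 (X 0)) z + pd 1 (pd 1 (X 0)) z) - 2 * pd 2 (X 0) z
        + 2 * ε * pd 2 (pd 0 (X 2)) z + 2 * γ * pd 0 (X 2) z ∧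
      2 * ε * pd 1 A z = ε * (pd 0 (pd 0 (X 1)) z + pd 1 (pd 1 (X 1)) z) - 2 * pd 2 (X 1) z
        + 2 * ε * pd 2 (pd 1 (X 2)) z + 2 * γ * pd 1 (X 2) z) ∧
    ε * pd 2 A z + γ * (A z + e₁) = 2 * ε * pd 2 (pd 0 (X 0)) z + 2 * γ * pd 0 (X 0) z ∧
    2 * pd 2 A z - ε * (pd 0 (pd 0 A) z + pd 1 (pd 1 A) z) = pd 2 (pd 2 (X 2)) z
      - ε * (pd 2 (pd 0 (pd 0 (X 2))) z + pd 2 (pd 1 (pd 1 (X 2))) z)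
      - γ * (pd 0 (pd 0 (X 2)) z + pd 1 (pd 1 (X 2)) z) := by
  have H : ∀ a b c : ℝ, _ := fun a b c => h ![a, b, c]
  simp only [linearisedSymbol, conjViscoOp, viscoSymbol, Fin.sum_univ_three, Matrix.cons_val_zero,
    Matrix.cons_val_one, Matrix.cons_val, pd_const] at H
  -- Each combination below is a central difference in `θ`, odd or even in each variable, that
  -- isolates one monomial.
  refine ⟨⟨?_, ?_, ?_, ?_, ?_⟩, ⟨?_, ?_, ?_⟩, ⟨?_, ?_⟩, ?_, ?_⟩
  · refine mul_left_cancel₀ hε ?_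
    linear_combination (H 2 0 0 - 2 * H 1 0 0 + 2 * H (-1) 0 0 - H (-2) 0 0) / 12
  · refine mul_left_cancel₀ hε ?_
    linear_combination (H 0 2 0 - 2 * H 0 1 0 + 2 * H 0 (-1) 0 - H 0 (-2) 0) / 12
  · refine mul_left_cancel₀ hε ?_
    linear_combination (H 1 0 1 + H 1 0 (-1) - 2 * H 1 0 0
      - (H (-1) 0 1 + H (-1) 0 (-1) - 2 * H (-1) 0 0)) / 8
  · refine mul_left_cancel₀ hε ?_
    linear_combination (H 0 1 1 + H 0 1 (-1) - 2 * H 0 1 0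
      - (H 0 (-1) 1 + H 0 (-1) (-1) - 2 * H 0 (-1) 0)) / 8
  · refine mul_left_cancel₀ hε ?_
    linear_combination (H 1 1 1 - H 1 1 (-1) - H 1 (-1) 1 + H 1 (-1) (-1)
      - (H (-1) 1 1 - H (-1) 1 (-1) - H (-1) (-1) 1 + H (-1) (-1) (-1))) / 16
  · refine mul_left_cancel₀ hε ?_
    linear_combination -(H 1 0 1 + H (-1) 0 1 - 2 * H 0 0 1
      - (H 1 0 (-1) + H (-1) 0 (-1) - 2 * H 0 0 (-1))) / 4
  · refine mul_left_cancel₀ hε ?_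
    linear_combination -(H 0 1 1 + H 0 (-1) 1 - 2 * H 0 0 1
      - (H 0 1 (-1) + H 0 (-1) (-1) - 2 * H 0 0 (-1))) / 4
  · linear_combination (H 0 0 1 + H 0 0 (-1) - 2 * H 0 0 0) / 2
  · linear_combination -(H 1 0 1 - H 1 0 (-1) - H (-1) 0 1 + H (-1) 0 (-1)) / 4
  · linear_combination -(H 0 1 1 - H 0 1 (-1) - H 0 (-1) 1 + H 0 (-1) (-1)) / 4
  · linear_combination -(H 1 0 0 + H (-1) 0 0 - 2 * H 0 0 0) / 2
  · linear_combination (H 0 0 1 - H 0 0 (-1)) / 2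

/-! ### Test functions with prescribed jets -/

/-- The function with value `a` and gradient `v` at `z₀` and constant image `b` under the
viscoelastic operator. -/
noncomputable def jetFun (z₀ : Base) (a : ℝ) (v : Base) (b : ℝ) (z : Base) : ℝ :=
  a + ∑ i, v i * (z i - z₀ i) + b / 2 * ((z 2 - z₀ 2) * (z 2 - z₀ 2))

@[fun_prop]
lemma contDiff_jetFun (z₀ : Base) (a : ℝ) (v : Base) (b : ℝ) :
    ContDiff ℝ ∞ (jetFun z₀ a v b) := by
  unfold jetFun
  fun_prop

lemma jetFun_self (z₀ : Base) (a : ℝ) (v : Base) (b : ℝ) : jetFun z₀ a v b z₀ = a := by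
  simp [jetFun]

lemma pd_jetFun (z₀ : Base) (a : ℝ) (v : Base) (b : ℝ) (i : Fin 3) :
    pd i (jetFun z₀ a v b) = fun z => v i + if i = 2 then b * (z 2 - z₀ 2) else 0 := by
  have e : jetFun z₀ a v b = fun z => a + (v 0 * (z 0 - z₀ 0) + v 1 * (z 1 - z₀ 1)
      + v 2 * (z 2 - z₀ 2)) + b / 2 * ((z 2 - z₀ 2) * (z 2 - z₀ 2)) := by
    funext z; simp [jetFun, Fin.sum_univ_three]
  rw [e]
  simp (disch := fun_prop) only [pd_add, pd_sub, pd_const_mul, pd_mul, pd_const, pd_coord]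
  funext z
  fin_cases i <;> simp
  ring

lemma pd_jetFun_self (z₀ : Base) (a : ℝ) (v : Base) (b : ℝ) (i : Fin 3) :
    pd i (jetFun z₀ a v b) z₀ = v i := by
  simp [pd_jetFun]

lemma viscoOp_jetFun (ε γ : ℝ) (z₀ : Base) (a : ℝ) (v : Base) (b : ℝ) :
    viscoOp ε γ (jetFun z₀ a v b) = fun _ => b := by
  rw [viscoOp_eq _ _ (by fun_prop)]
  simp (disch := fun_prop) [pd_jetFun, pd_const, pd_add, pd_const_mul, pd_sub, pd_coord]

lemma pd_comp_graph {g : Total → ℝ} (hg : ContDiff ℝ ∞ g) {u f : Base → ℝ}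
    (hu : ContDiff ℝ ∞ u) (hf : ContDiff ℝ ∞ f) (i : Fin 3) (z : Base) :
    pd i (fun z => g (z, u z, f z)) z
      = fderiv ℝ g (z, u z, f z) (Pi.single i 1, pd i u z, pd i f z) := by
  have h1 : HasFDerivAt (fun z => (z, u z, f z))
      ((ContinuousLinearMap.id ℝ Base).prod ((fderiv ℝ u z).prod (fderiv ℝ f z))) z :=
    (hasFDerivAt_id z).prodMk ((differentiable_of_smooth hu z).hasFDerivAt.prodMk
      (differentiable_of_smooth hf z).hasFDerivAt)
  have h2 := (differentiable_of_smooth hg (z, u z, f z)).hasFDerivAt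
  have h3 : HasFDerivAt (fun z => g (z, u z, f z)) _ z := h2.comp z h1
  rw [pd, h3.fderiv]
  rfl

/-- If the total derivative of `g` vanishes along all solutions, then so do the corresponding
partial derivative and the derivative with respect to `u`. -/
lemma fderiv_eq_zero_of_pd_comp_graph (ε γ : ℝ) {g : Total → ℝ} (hg : ContDiff ℝ ∞ g) (i : Fin 3)
    (h : ∀ u, ContDiff ℝ ∞ u → ∀ z, pd i (fun z => g (z, u z, viscoOp ε γ u z)) z = 0)
    (p : Total) :
    fderiv ℝ g p (Pi.single i 1, 0, 0) = 0 ∧ fderiv ℝ g p (0, 1, 0) = 0 := by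
  -- Along `jetFun` the image under `L` is constant, so the total derivative has no `f` term: it is
  -- `∂ᵢg + vᵢ g_u` with `v` free. Two choices of `v` separate the summands.
  have key : ∀ v : Base, fderiv ℝ g p (Pi.single i 1, v i, 0) = 0 := fun v => by
    have hu := contDiff_jetFun p.1 p.2.1 v p.2.2
    have := h _ hu p.1
    rw [pd_comp_graph hg hu (contDiff_viscoOp ε γ hu)] at this
    simpa [viscoOp_jetFun, jetFun_self, pd_jetFun_self, pd_const] using this
  have h0 := key 0
  have h1 := key fun _ => 1
  refine ⟨h0, ?_⟩
  have e : ((0, 1, 0) : Total) = (Pi.single i 1, 1, 0) - (Pi.single i 1, 0, 0) := by simp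
  rw [e, map_sub]
  simpa using (sub_eq_zero.2 (h1.trans h0.symm))

lemma eq_of_vertical_fderiv_eq_zero {g : Total → ℝ} (hg : ContDiff ℝ ∞ g)
    (hu : ∀ p, fderiv ℝ g p (0, 1, 0) = 0) (hf : ∀ p, fderiv ℝ g p (0, 0, 1) = 0) (p : Total) :
    g p = g (p.1, 0, 0) := by
  have hd := differentiable_of_smooth hg
  have h : ∀ y : ℝ × ℝ, HasFDerivAt (fun y => g (p.1, y)) (0 : ℝ × ℝ →L[ℝ] ℝ) y := by
    intro y
    have h1 : HasFDerivAt (fun y : ℝ × ℝ => (p.1, y)) (ContinuousLinearMap.inr ℝ Base (ℝ × ℝ)) y :=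
      hasFDerivAt_prodMk_right p.1 y
    have h3 : HasFDerivAt (fun y => g (p.1, y)) _ y := (hd (p.1, y)).hasFDerivAt.comp y h1
    have e : (fderiv ℝ g (p.1, y)).comp (ContinuousLinearMap.inr ℝ Base (ℝ × ℝ)) = 0 := by
      ext
      · simpa using hu (p.1, y)
      · simpa using hf (p.1, y)
    exact e ▸ h3
  exact is_const_of_fderiv_eq_zero (𝕜 := ℝ) (fun y => (h y).differentiableAt)
    (fun y => (h y).fderiv) p.2 (0, 0)

lemma fderiv_eq_sum_pd (g : Base → ℝ) (z v : Base) : fderiv ℝ g z v = ∑ i, v i * pd i g z := by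
  have : v = ∑ i, v i • (Pi.single i 1 : Base) := by
    ext j; simp [Finset.sum_apply, Pi.single_apply]
  conv_lhs => rw [this]
  simp [pd]

lemma eq_const_of_pd_eq_zero {g : Base → ℝ} (hg : ContDiff ℝ ∞ g) (h : ∀ i z, pd i g z = 0)
    (z : Base) : g z = g 0 := by
  refine is_const_of_fderiv_eq_zero (𝕜 := ℝ) (differentiable_of_smooth hg) (fun z => ?_) z 0
  ext1 v
  simp [fderiv_eq_sum_pd, h]

lemma eq_affine_of_pd_eq_const {g : Base → ℝ} (hg : ContDiff ℝ ∞ g) (d : Base)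
    (h : ∀ i z, pd i g z = d i) (z : Base) : g z = g 0 + (d 0 * z 0 + d 1 * z 1 + d 2 * z 2) := by
  have hk : ContDiff ℝ ∞ (fun z : Base => g z - (d 0 * z 0 + d 1 * z 1 + d 2 * z 2)) := by fun_prop
  have := eq_const_of_pd_eq_zero hk (fun i z => by
    simp (disch := fun_prop) only [pd_add, pd_sub, pd_const_mul, pd_coord, h]
    fin_cases i <;> simp) z
  simp at this
  linarith

/-! ### Solution of the determining equations -/

lemma fderiv_clm_comp {V : Total → Total} (hV : ContDiff ℝ ∞ V) (l : Total →L[ℝ] ℝ)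
    (p v : Total) : fderiv ℝ (fun p => l (V p)) p v = l (fderiv ℝ V p v) := by
  have h := (differentiable_of_smooth hV p).hasFDerivAt
  have h2 : HasFDerivAt (fun p => l (V p)) _ p := l.hasFDerivAt.comp p h
  rw [h2.fderiv]
  rfl

lemma fderiv_base_component {V : Total → Total} (hV : ContDiff ℝ ∞ V) (i : Fin 3) (p v : Total) :
    fderiv ℝ (fun p => (V p).1 i) p v = (fderiv ℝ V p v).1 i :=
  fderiv_clm_comp hV ((ContinuousLinearMap.proj (R := ℝ) (φ := fun _ : Fin 3 => ℝ) i).comp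
      (ContinuousLinearMap.fst ℝ Base (ℝ × ℝ))) p v

lemma fderiv_u_component {V : Total → Total} (hV : ContDiff ℝ ∞ V) (p v : Total) :
    fderiv ℝ (fun p => (V p).2.1) p v = (fderiv ℝ V p v).2.1 :=
  fderiv_clm_comp hV ((ContinuousLinearMap.fst ℝ ℝ ℝ).comp
    (ContinuousLinearMap.snd ℝ Base (ℝ × ℝ))) p v

/-- The linearised invariance condition in terms of the coefficient functions along a solution. -/
lemma IsInvariantAlongSolutions.linearisedSymbol_eq_zero {ε γ : ℝ} {V : Total → Total}
    (hV : ContDiff ℝ ∞ V) (h : IsInvariantAlongSolutions ε γ V) {u : Base → ℝ}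
    (hu : ContDiff ℝ ∞ u) (z : Base) :
    ∃ e₀ e₁ : ℝ, ∀ θ : Base, linearisedSymbol ε γ (characteristicU (derivU V) u (viscoOp ε γ u))
      (characteristicU (derivF V) u (viscoOp ε γ u))
      (fun i w => (V (w, u w, viscoOp ε γ u w)).1 i) e₀ e₁ z θ = 0 := by
  obtain ⟨e₀, e₁, H⟩ := h.linearised hV hu rfl z
  have hf := contDiff_viscoOp ε γ hu
  refine ⟨e₀, e₁, fun θ => ?_⟩
  rw [← H θ, conjViscoOp_combination ε γ _ θ (contDiff_characteristicU (by fun_prop) hu hf)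
    (contDiff_characteristicU (by fun_prop) hu hf) (X := fun i w =>
      (V (w, u w, viscoOp ε γ u w)).1 i) (fun i => by fun_prop), linearisedSymbol]

lemma IsInvariantAlongSolutions.characteristicU_derivF {ε γ : ℝ} (hε : ε ≠ 0) {V : Total → Total}
    (hV : ContDiff ℝ ∞ V) (h : IsInvariantAlongSolutions ε γ V) {u : Base → ℝ}
    (hu : ContDiff ℝ ∞ u) : characteristicU (derivF V) u (viscoOp ε γ u) = fun _ => 0 := by
  funext z
  obtain ⟨e₀, e₁, H⟩ := h.linearisedSymbol_eq_zero hV hu z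
  exact eq_zero_of_linearisedSymbol hε H

lemma IsInvariantAlongSolutions.derivF_eq_zero {ε γ : ℝ} (hε : ε ≠ 0) {V : Total → Total}
    (hV : ContDiff ℝ ∞ V) (h : IsInvariantAlongSolutions ε γ V) (p : Total) :
    (derivF V p).2.1 = 0 ∧ ∀ i, (derivF V p).1 i = 0 := by
  -- The characteristic is affine in the gradient of `u`, which can be prescribed freely over a
  -- fixed point `p`.
  have key : ∀ v : Base, (derivF V p).2.1 - ∑ i, (derivF V p).1 i * v i = 0 := fun v => by
    have := congrFun (h.characteristicU_derivF hε hV (contDiff_jetFun p.1 p.2.1 v p.2.2)) p.1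
    simpa only [characteristicU, viscoOp_jetFun, jetFun_self, pd_jetFun_self] using this
  have h0 : (derivF V p).2.1 = 0 := by simpa using key 0
  exact ⟨h0, fun i => by simpa [h0, Pi.single_apply] using key (Pi.single i 1)⟩

/-- The components `ξ` and `φ₁` of a vector field that satisfies the invariance condition. -/
lemma IsInvariantAlongSolutions.components {ε γ : ℝ} (hε : ε ≠ 0) (hγ : γ ≠ 0)
    {V : Total → Total} (hV : ContDiff ℝ ∞ V) (h : IsInvariantAlongSolutions ε γ V) :
    ∃ c : Fin 5 → ℝ, (∀ p, (V p).1 = ![c 0 + c 3 * p.1 1, c 1 - c 3 * p.1 0, c 2]) ∧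
      ∀ p, (V p).2.1 = c 4 * p.2.1 + (V (p.1, 0, 0)).2.1 := by
  have hdF := h.derivF_eq_zero hε hV
  have hξs : ∀ i, ContDiff ℝ ∞ (fun p => (V p).1 i) := fun i => by fun_prop
  choose e₀ e₁ H using fun u (hu : ContDiff ℝ ∞ u) z => h.linearisedSymbol_eq_zero hV hu z
  have H' : ∀ u (hu : ContDiff ℝ ∞ u) z θ, _ := fun u hu z θ =>
    h.characteristicU_derivF hε hV hu ▸ H u hu z θ
  have eqs := fun u (hu : ContDiff ℝ ∞ u) z => determining_equations hε (H' u hu z)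
  -- the coefficients of the independent variables depend on the independent variables only
  have hξf : ∀ i p, fderiv ℝ (fun p => (V p).1 i) p (0, 0, 1) = 0 := fun i p => by
    rw [fderiv_base_component hV]; exact (hdF p).2 i
  have hξu : ∀ i p, fderiv ℝ (fun p => (V p).1 i) p (0, 1, 0) = 0 := by
    have h0 := fderiv_eq_zero_of_pd_comp_graph ε γ (hξs 0) 2
      fun u hu z => (eqs u hu z).1.1
    have h1 := fderiv_eq_zero_of_pd_comp_graph ε γ (hξs 1) 2
      fun u hu z => (eqs u hu z).1.2.1
    have h2 := fderiv_eq_zero_of_pd_comp_graph ε γ (hξs 2) 0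
      fun u hu z => (eqs u hu z).1.2.2.1
    intro i p
    fin_cases i
    exacts [(h0 p).2, (h1 p).2, (h2 p).2]
  let k : Fin 3 → Base → ℝ := fun i z => (V (z, 0, 0)).1 i
  have hk : ∀ i, ContDiff ℝ ∞ (k i) := fun i => by simp only [k]; fun_prop
  have hVk : ∀ i p, (V p).1 i = k i p.1 := fun i p =>
    eq_of_vertical_fderiv_eq_zero (hξs i) (hξu i) (hξf i) p
  simp only [hVk] at eqs
  -- the coefficients of the independent variables are affine
  have e0 := fun z => (eqs 0 contDiff_const z)
  have X2 : pd 2 (k 0) = fun _ => 0 := funext fun z => (e0 z).1.1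
  have Y2 : pd 2 (k 1) = fun _ => 0 := funext fun z => (e0 z).1.2.1
  have T0 : pd 0 (k 2) = fun _ => 0 := funext fun z => (e0 z).1.2.2.1
  have T1 : pd 1 (k 2) = fun _ => 0 := funext fun z => (e0 z).1.2.2.2.1
  have Y0 : pd 0 (k 1) = fun z => -1 * pd 1 (k 0) z := funext fun z => by
    linarith [(e0 z).1.2.2.2.2]
  have Y1 : pd 1 (k 1) = pd 0 (k 0) := funext fun z => by
    linarith [(e0 z).2.1.1, (e0 z).2.1.2.1]
  have T2 : pd 2 (k 2) = fun z => 2 * pd 0 (k 0) z := funext fun z => by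
    have h1 := (e0 z).2.1.1
    have h2 := (e0 z).2.1.2.2
    simp only [T0, T1, pd_const] at h2
    linarith
  -- Since the time component depends on `t` alone, this makes `pd 0 (k 0)` independent of `x` and
  -- `y`.
  have X0T : pd 0 (k 0) = fun z => 1 / 2 * pd 2 (k 2) z := by
    rw [T2]; funext z; ring
  have X00 : pd 0 (pd 0 (k 0)) = fun _ => 0 := by
    rw [X0T, pd_const_mul (by fun_prop), pd_comm (hk 2), T0, pd_const]; simp
  have X10 : pd 1 (pd 0 (k 0)) = fun _ => 0 := by
    rw [X0T, pd_const_mul (by fun_prop), pd_comm (hk 2), T1, pd_const]; simp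
  have X20 : pd 2 (pd 0 (k 0)) = fun _ => 0 := by
    rw [pd_comm (hk 0), X2, pd_const]
  have X11 : pd 1 (pd 1 (k 0)) = fun _ => 0 := by
    have : pd 1 (k 0) = fun z => -1 * pd 0 (k 1) z := by rw [Y0]; funext z; ring
    rw [this, pd_const_mul (by fun_prop), pd_comm (hk 1), Y1, X00]; simp
  obtain ⟨c, hc⟩ : ∃ c, pd 0 (k 0) = fun _ => c := ⟨_, funext fun z =>
    eq_const_of_pd_eq_zero (by fun_prop) (fun i z => by fin_cases i <;> simp [X00, X10, X20]) z⟩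
  obtain ⟨d, hd⟩ : ∃ d, pd 1 (k 0) = fun _ => d := ⟨_, funext fun z =>
    eq_const_of_pd_eq_zero (by fun_prop) (fun i z => by
      fin_cases i
      · simp [pd_comm (hk 0) 0 1, X10]
      · simp [X11]
      · simp [pd_comm (hk 0) 2 1, X2, pd_const]) z⟩
  rw [hc] at Y1 T2
  rw [hd] at Y0
  -- the coefficient of `∂_u` is affine in `u`
  let g : Total → ℝ := fun p => (derivU V p).2.1
  have hg : ContDiff ℝ ∞ g := by simp only [g]; fun_prop
  have hchar : ∀ u, characteristicU (derivU V) u (viscoOp ε γ u)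
      = fun z => g (z, u z, viscoOp ε γ u z) := fun u => funext fun z => by
    have : ∀ p i, (derivU V p).1 i = 0 := fun p i => by
      rw [derivU, ← fderiv_base_component hV]; exact hξu i p
    simp [characteristicU, this, g]
  have eqA := fun u (hu : ContDiff ℝ ∞ u) z => (eqs u hu z).2
  simp only [hchar, hc, hd, X2, Y0, Y1, Y2, T0, T1, T2, pd_const] at eqA
  have A0 : ∀ u, ContDiff ℝ ∞ u →
      pd 0 (fun z => g (z, u z, viscoOp ε γ u z)) = fun _ => 0 := fun u hu => funext fun z => by
    have := (eqA u hu z).2.1.1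
    simpa [hε] using this
  have A1 : ∀ u, ContDiff ℝ ∞ u →
      pd 1 (fun z => g (z, u z, viscoOp ε γ u z)) = fun _ => 0 := fun u hu => funext fun z => by
    have := (eqA u hu z).2.1.2
    simpa [hε] using this
  have A2 : ∀ u, ContDiff ℝ ∞ u →
      pd 2 (fun z => g (z, u z, viscoOp ε γ u z)) = fun _ => 0 := fun u hu => funext fun z => by
    have := (eqA u hu z).2.2.2
    simpa [A0 u hu, A1 u hu, pd_const] using this
  -- The remaining candidate is the dilation with weights `(1, 1, 2)` on `(x, y, t)`. It scales
  -- `u_tt` and the `ε` term alike but not the `γ` term: the equations give `4γc = 2γc`.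
  have hc0 : c = 0 := by
    have h1 := (eqA 0 contDiff_const 0).2.2.1
    have h2 := (eqA 0 contDiff_const 0).1.1
    rw [A2 0 contDiff_const, h2] at h1
    refine (mul_eq_zero.1 (?_ : γ * c = 0)).resolve_left hγ
    linarith
  have G0 := fderiv_eq_zero_of_pd_comp_graph ε γ hg 0 fun u hu z => congrFun (A0 u hu) z
  have G1 := fderiv_eq_zero_of_pd_comp_graph ε γ hg 1 fun u hu z => congrFun (A1 u hu) z
  have G2 := fderiv_eq_zero_of_pd_comp_graph ε γ hg 2 fun u hu z => congrFun (A2 u hu) z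
  have hφ : ContDiff ℝ ∞ (fun p => (V p).2.1) := by fun_prop
  have hφf : ∀ p, fderiv ℝ (fun p => (V p).2.1) p (0, 0, 1) = 0 := fun p => by
    rw [fderiv_u_component hV]; exact (hdF p).1
  have hgφ : g = fun p => fderiv ℝ (fun p => (V p).2.1) p (0, 1, 0) := funext fun p => by
    rw [fderiv_u_component hV]; rfl
  -- `g` is the `u`-derivative of `φ₁`, and `φ₁` does not depend on `f`; the mixed derivatives
  -- commute.
  have Gf : ∀ p, fderiv ℝ g p (0, 0, 1) = 0 := fun p => by
    rw [hgφ, fderiv_fderiv_apply_comm hφ]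
    simp [hφf]
  have hg0 : ∀ p, g p = g 0 := fun p => by
    rw [eq_of_vertical_fderiv_eq_zero hg (fun p => (G0 p).2) Gf p]
    refine eq_const_of_pd_eq_zero (g := fun z => g (z, 0, 0)) (by fun_prop) (fun i z => ?_) p.1
    rw [pd_comp_graph hg contDiff_const contDiff_const]
    simp only [pd_const]
    fin_cases i
    exacts [(G0 _).1, (G1 _).1, (G2 _).1]
  -- Translations are the values of `ξ` at the origin, the rotation rate is `∂_y ξ⁰`, and the
  -- scaling rate is the constant `∂φ₁/∂u`.
  refine ⟨![k 0 0, k 1 0, k 2 0, d, g 0], fun p => ?_, fun p => ?_⟩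
  · have x := eq_affine_of_pd_eq_const (hk 0) ![0, d, 0]
      (fun i z => by fin_cases i <;> simp [hc, hd, X2, hc0]) p.1
    have y := eq_affine_of_pd_eq_const (hk 1) ![-d, 0, 0]
      (fun i z => by fin_cases i <;> simp [Y0, Y1, Y2, hc0]) p.1
    have t := eq_affine_of_pd_eq_const (hk 2) ![0, 0, 0]
      (fun i z => by fin_cases i <;> simp [T0, T1, T2, hc0]) p.1
    ext i
    rw [hVk]
    fin_cases i
    · simp [x]
    · simp [y]; ring
    · simp [t]
  · have hw : ContDiff ℝ ∞ (fun p : Total => (V p).2.1 - g 0 * p.2.1) := by fun_prop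
    have hsub : ∀ p v, fderiv ℝ (fun p : Total => (V p).2.1 - g 0 * p.2.1) p v =
        fderiv ℝ (fun p => (V p).2.1) p v - g 0 * v.2.1 := fun p v => by
      let l : Total →L[ℝ] ℝ :=
        (ContinuousLinearMap.fst ℝ ℝ ℝ).comp (ContinuousLinearMap.snd ℝ Base (ℝ × ℝ))
      have h1 : HasFDerivAt (fun p : Total => p.2.1) l p := l.hasFDerivAt
      have h2 := ((differentiable_of_smooth hφ p).hasFDerivAt).fun_sub (h1.const_mul (g 0))
      rw [h2.fderiv]
      simp [l]
    have := eq_of_vertical_fderiv_eq_zero hw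
      (fun p => by rw [hsub, ← congrFun hgφ p, hg0 p]; simp)
      (fun p => by rw [hsub, hφf]; simp) p
    simp at this
    simp
    linarith

/-- Vector fields satisfying the invariance condition are combinations of the generators. -/
lemma IsInvariantAlongSolutions.exists_eq {ε γ : ℝ} (hε : ε ≠ 0) (hγ : γ ≠ 0)
    {V : Total → Total} (hV : ContDiff ℝ ∞ V) (h : IsInvariantAlongSolutions ε γ V) :
    ∃ (c : Fin 5 → ℝ) (α : Base → ℝ), ContDiff ℝ ∞ α ∧ V = ∑ i, c i • X i + Xα ε γ α := by
  obtain ⟨c, hξ, hφ⟩ := h.components hε hγ hV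
  have hα : ContDiff ℝ ∞ (fun z : Base => (V (z, 0, 0)).2.1) := by fun_prop
  refine ⟨c, fun z => (V (z, 0, 0)).2.1, hα, funext fun p => ?_⟩
  -- This test function passes through an arbitrary `p`, with `L u` equal to its `f` coordinate. The
  -- invariance condition there solves for `φ₂`.
  have hu := contDiff_jetFun p.1 p.2.1 0 p.2.2
  have h1 := h _ hu p.1
  rw [viscoOp_characteristicU ε γ c hα hu hξ hφ] at h1
  simp only [viscoOp_jetFun, jetFun_self] at h1
  refine Prod.ext ?_ (Prod.ext ?_ ?_)
  · rw [hξ p]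
    ext i
    fin_cases i <;> simp [Fin.sum_univ_five, X, X₁, X₂, X₃, X₄, X₅, Xα, verticalField]
    ring
  · rw [hφ p]
    simp [Fin.sum_univ_five, X, X₁, X₂, X₃, X₄, X₅, Xα, verticalField]
  · simp [Fin.sum_univ_five, X, X₁, X₂, X₃, X₄, X₅, Xα, verticalField]
    linarith

lemma isInfinitesimalSymmetry_combination (ε γ : ℝ) (c : Fin 5 → ℝ) {α : Base → ℝ}
    (hα : ContDiff ℝ ∞ α) {V : Total → Total} (hV : ContDiff ℝ ∞ V)
    (h : V = ∑ i, c i • X i + Xα ε γ α) : IsInfinitesimalSymmetry ε γ V := by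
  intro u f hu hf z hz
  have hξ : ∀ p, (V p).1 = ![c 0 + c 3 * p.1 1, c 1 - c 3 * p.1 0, c 2] := fun p => by
    ext i
    fin_cases i <;> simp [h, Fin.sum_univ_five, X, X₁, X₂, X₃, X₄, X₅, Xα, verticalField]
    ring
  have hφ : ∀ p, (V p).2.1 = c 4 * p.2.1 + α p.1 := fun p => by
    simp [h, Fin.sum_univ_five, X, X₁, X₂, X₃, X₄, X₅, Xα, verticalField]
  rw [prolongEquation_eq ε γ hV hu hf, viscoOp_characteristicU ε γ c hα hu hξ hφ, hz]
  simp [h, Fin.sum_univ_five, X, X₁, X₂, X₃, X₄, X₅, Xα, verticalField]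

/-- The characteristic of `α ∂_u` is `α` itself, whatever the solution, so the zero solution already
tests the whole condition. -/
lemma isInfinitesimalSymmetry_verticalField_iff (ε γ : ℝ) {α : Base → ℝ} (hα : ContDiff ℝ ∞ α) :
    IsInfinitesimalSymmetry ε γ (verticalField α 0) ↔ ∀ z, viscoOp ε γ α z = 0 := by
  have hV : ContDiff ℝ ∞ (verticalField α 0) := by
    have : ContDiff ℝ ∞ (fun p : Total => ((0 : Base), α p.1, (0 : ℝ))) := by fun_prop
    exact this
  have key : ∀ u f : Base → ℝ, ContDiff ℝ ∞ u → ContDiff ℝ ∞ f → ∀ z,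
      prolongEquation ε γ (verticalField α 0) u f z = viscoOp ε γ α z := by
    intro u f hu hf z
    have hc : characteristicU (verticalField α 0) u f = α := funext fun z => by
      simp [characteristicU, verticalField]
    rw [prolongEquation_eq ε γ hV hu hf, hc]
    simp [verticalField]
  refine ⟨fun h z => ?_, fun h u f hu hf z _ => (key u f hu hf z).trans (h z)⟩
  have h0 : ContDiff ℝ ∞ (fun _ : Base => (0 : ℝ)) := contDiff_const
  rw [← key _ _ h0 h0 z]
  refine h _ _ h0 h0 z ?_
  rw [viscoOp_eq ε γ h0]
  simp [pd_const]

/-! ### The one-parameter groups generated by the listed vector fields -/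

/-- The map `z ↦ R z + b`, where `R` acts on `(x, y)` by the matrix with rows `(a, d)`, `(-d, a)`
and trivially on `t`. -/
def rigidMotion (a d : ℝ) (b z : Base) : Base :=
  ![a * z 0 + d * z 1 + b 0, -d * z 0 + a * z 1 + b 1, z 2 + b 2]

@[fun_prop]
lemma contDiff_rigidMotion (a d : ℝ) (b : Base) : ContDiff ℝ ∞ (rigidMotion a d b) := by
  rw [contDiff_pi]
  intro i
  fin_cases i <;> simp [rigidMotion] <;> fun_prop

lemma fderiv_rigidMotion_single (a d : ℝ) (b z : Base) (i : Fin 3) :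
    fderiv ℝ (rigidMotion a d b) z (Pi.single i 1) = rigidMotion a d 0 (Pi.single i 1) := by
  have hd : DifferentiableAt ℝ (rigidMotion a d b) z :=
    differentiable_of_smooth (contDiff_rigidMotion a d b) z
  ext j
  have h1 : fderiv ℝ (rigidMotion a d b) z (Pi.single i 1) j
      = pd i (fun w => rigidMotion a d b w j) z := by
    rw [pd, fderiv_apply hd]
    rfl
  rw [h1]
  fin_cases j <;> simp only [rigidMotion, Fin.zero_eta, Fin.mk_one, Fin.reduceFinMk,
    Matrix.cons_val_zero, Matrix.cons_val_one, Matrix.cons_val] <;>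
  simp (disch := fun_prop) only [pd_add, pd_const_mul, pd_coord, pd_const] <;>
  fin_cases i <;> simp

lemma pd_comp_rigidMotion (a d : ℝ) (b : Base) {g : Base → ℝ} (hg : ContDiff ℝ ∞ g) :
    pd 0 (fun z => g (rigidMotion a d b z)) = (fun z => a * pd 0 g (rigidMotion a d b z)
        - d * pd 1 g (rigidMotion a d b z)) ∧
    pd 1 (fun z => g (rigidMotion a d b z)) = (fun z => d * pd 0 g (rigidMotion a d b z)
        + a * pd 1 g (rigidMotion a d b z)) ∧
    pd 2 (fun z => g (rigidMotion a d b z)) = fun z => pd 2 g (rigidMotion a d b z) := by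
  have key : ∀ i z, pd i (fun z => g (rigidMotion a d b z)) z
      = ∑ j, rigidMotion a d 0 (Pi.single i 1) j * pd j g (rigidMotion a d b z) := fun i z => by
    have hd := differentiable_of_smooth (contDiff_rigidMotion a d b) z
    have h : HasFDerivAt (fun z => g (rigidMotion a d b z)) _ z :=
      (differentiable_of_smooth hg _).hasFDerivAt.comp z hd.hasFDerivAt
    rw [pd, h.fderiv, ← fderiv_eq_sum_pd, ← fderiv_rigidMotion_single a d b z]
    rfl
  refine ⟨?_, ?_, ?_⟩ <;> funext z <;> rw [key] <;>
    simp [Fin.sum_univ_three, rigidMotion]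
  ring

/-- The linear map with rows `(a, d)`, `(-d, a)` multiplies the Laplacian by `a² + d²` and leaves
`∂_t` unchanged. -/
lemma viscoOp_comp_rigidMotion (ε γ : ℝ) {a d : ℝ} (had : a ^ 2 + d ^ 2 = 1) (b : Base)
    {g : Base → ℝ} (hg : ContDiff ℝ ∞ g) (z : Base) :
    viscoOp ε γ (fun z => g (rigidMotion a d b z)) z = viscoOp ε γ g (rigidMotion a d b z) := by
  have h0 := fun {g : Base → ℝ} (hg : ContDiff ℝ ∞ g) => (pd_comp_rigidMotion a d b hg).1
  have h1 := fun {g : Base → ℝ} (hg : ContDiff ℝ ∞ g) => (pd_comp_rigidMotion a d b hg).2.1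
  have h2 := fun {g : Base → ℝ} (hg : ContDiff ℝ ∞ g) => (pd_comp_rigidMotion a d b hg).2.2
  rw [viscoOp_eq ε γ hg, viscoOp_eq ε γ (by fun_prop)]
  simp (disch := fun_prop) only [h0, h1, h2, pd_add, pd_sub, pd_const_mul]
  simp (disch := fun_prop) only [pd_comm _ 1 0]
  linear_combination -(ε * (pd 2 (pd 0 (pd 0 g)) (rigidMotion a d b z)
    + pd 2 (pd 1 (pd 1 g)) (rigidMotion a d b z)) + γ * (pd 0 (pd 0 g) (rigidMotion a d b z)
    + pd 1 (pd 1 g) (rigidMotion a d b z))) * had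

/-- The point transformation composed of a rigid motion, a scaling by `r` and the superposition
of `(α, β)`. -/
def pointTransformation (a d : ℝ) (b : Base) (r : ℝ) (α β : Base → ℝ) (p : Total) : Total :=
  (rigidMotion a d b p.1, r * p.2.1 + α p.1, r * p.2.2 + β p.1)

/-- Equality of the graphs gives `u' ∘ R = r u + α` and `f' ∘ R = r f + L α` on `Ω`, and `R` maps
`Ω` onto `Ω'`. The equation follows from invariance and linearity of `L`. As `L` is local, germs may
be replaced by globally smooth extensions. -/
lemma IsSolutionOn.pointTransformation {ε γ a d r : ℝ} (had : a ^ 2 + d ^ 2 = 1) {b : Base}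
    {α : Base → ℝ} (hα : ContDiff ℝ ∞ α) {Ω Ω' : Set Base} {u f u' f' : Base → ℝ}
    (hΩ : IsOpen Ω) (hΩ' : IsOpen Ω') (h : IsSolutionOn ε γ u f Ω) (hu' : ContDiffOn ℝ ∞ u' Ω')
    (hf' : ContDiffOn ℝ ∞ f' Ω')
    (hT : pointTransformation a d b r α (viscoOp ε γ α) '' graphOver u f Ω = graphOver u' f' Ω') :
    IsSolutionOn ε γ u' f' Ω' := by
  refine ⟨hu', hf', fun w hw => ?_⟩
  have hval : ∀ z ∈ Ω, u' (rigidMotion a d b z) = r * u z + α z ∧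
      f' (rigidMotion a d b z) = r * f z + viscoOp ε γ α z := fun z hz => by
    have : Viscoelastic.pointTransformation a d b r α (viscoOp ε γ α) (z, u z, f z)
        ∈ graphOver u' f' Ω' := hT ▸ ⟨_, ⟨z, hz, rfl⟩, rfl⟩
    obtain ⟨w, -, hw⟩ := this
    simp only [Viscoelastic.pointTransformation, Prod.mk.injEq] at hw
    obtain ⟨rfl, h1, h2⟩ := hw
    exact ⟨h1, h2⟩
  obtain ⟨z, hz, rfl⟩ : ∃ z ∈ Ω, rigidMotion a d b z = w := by
    have : ((w, u' w, f' w) : Total) ∈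
        Viscoelastic.pointTransformation a d b r α (viscoOp ε γ α) '' graphOver u f Ω :=
      hT ▸ ⟨w, hw, rfl⟩
    obtain ⟨_, ⟨z, hz, rfl⟩, h2⟩ := this
    exact ⟨z, hz, congrArg Prod.fst h2⟩
  obtain ⟨v', hv', hvu'⟩ := exists_contDiff_eventuallyEq hΩ' hu' hw
  obtain ⟨v, hv, hvu⟩ := exists_contDiff_eventuallyEq hΩ h.1 hz
  have e : (fun z => v' (rigidMotion a d b z)) =ᶠ[𝓝 z] fun z => r * v z + α z := by
    have hc : Tendsto (rigidMotion a d b) (𝓝 z) (𝓝 (rigidMotion a d b z)) :=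
      (contDiff_rigidMotion a d b).continuous.continuousAt
    filter_upwards [hc.eventually hvu', hvu, hΩ.mem_nhds hz] with y h1 h2 h3
    rw [h1, h2, (hval y h3).1]
  rw [← (viscoOp_congr ε γ hvu').eq_of_nhds, ← viscoOp_comp_rigidMotion ε γ had b hv' z,
    (viscoOp_congr ε γ e).eq_of_nhds, viscoOp_add _ _ (by fun_prop) hα,
    viscoOp_const_mul _ _ _ hv, (hval z hz).2]
  simp only
  rw [(viscoOp_congr ε γ hvu).eq_of_nhds, h.2.2 z hz]

/-- Common criterion for all the explicit flows: translations, rotations, scalings and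
superpositions are special cases of one family of maps. -/
lemma LocalOneParameterGroup.isSymmetryGroup_of_pointTransformation (Φ : LocalOneParameterGroup)
    {ε γ : ℝ} (h : ∀ s, ∃ (a d : ℝ) (b : Base) (r : ℝ) (α : Base → ℝ), a ^ 2 + d ^ 2 = 1 ∧
      ContDiff ℝ ∞ α ∧ Φ.map s = pointTransformation a d b r α (viscoOp ε γ α)) :
    Φ.IsSymmetryGroup ε γ := by
  intro s Ω Ω' u f u' f' hΩ hΩ' hsol _ hu' hf' hT
  obtain ⟨a, d, b, r, α, had, hα, hs⟩ := h s
  exact hsol.pointTransformation had hα hΩ hΩ' hu' hf' (hs ▸ hT)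

/-- A global flow as a one-parameter group. -/
def globalGroup (map : ℝ → Total → Total)
    (smooth : ContDiff ℝ ∞ (fun q : ℝ × Total => map q.1 q.2)) (map_zero : ∀ p, map 0 p = p)
    (map_add : ∀ r s p, map s (map r p) = map (s + r) p) : LocalOneParameterGroup where
  dom := Set.univ
  map := map
  isOpen_dom := isOpen_univ
  zero_mem _ := trivial
  smooth := smooth.contDiffOn
  map_zero := map_zero
  map_add r s p _ _ _ := map_add r s p
  neg_mem _ _ _ := trivial

lemma viscoOp_zero (ε γ : ℝ) : viscoOp ε γ (fun _ => 0) = fun _ => 0 := by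
  rw [viscoOp_eq ε γ contDiff_const]
  simp [pd_const]

/-- Translations of the independent variables. -/
lemma exists_group_translation (ε γ : ℝ) (b : Base) : ∃ Φ : LocalOneParameterGroup,
    Φ.dom = Set.univ ∧ Φ.IsSymmetryGroup ε γ ∧ Φ.generator = fun _ => (b, 0, 0) := by
  refine ⟨globalGroup (fun s p => (p.1 + s • b, p.2)) (by fun_prop) (fun p => by simp)
    (fun r s p => by ext <;> simp; ring), rfl, ?_, ?_⟩
  · refine LocalOneParameterGroup.isSymmetryGroup_of_pointTransformation _ fun s =>
      ⟨1, 0, s • b, 1, fun _ => 0, by norm_num, contDiff_const, funext fun p => ?_⟩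
    rw [viscoOp_zero]
    refine Prod.ext (funext fun i => ?_) (by simp [globalGroup, pointTransformation])
    fin_cases i <;> simp [globalGroup, pointTransformation, rigidMotion]
  · funext p
    have : HasDerivAt (fun s : ℝ => ((p.1 + s • b, p.2) : Total)) ((1 : ℝ) • b, 0) 0 :=
      (((hasDerivAt_id (0 : ℝ)).smul_const b).const_add p.1).prodMk (hasDerivAt_const _ _)
    exact this.deriv.trans (by simp; rfl)

lemma exists_group_rotation (ε γ : ℝ) : ∃ Φ : LocalOneParameterGroup,
    Φ.dom = Set.univ ∧ Φ.IsSymmetryGroup ε γ ∧ Φ.generator = X₄ := by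
  refine ⟨globalGroup (fun s p => (rigidMotion (Real.cos s) (Real.sin s) 0 p.1, p.2)) ?_ ?_ ?_,
    rfl, ?_, ?_⟩
  · refine ContDiff.prodMk ?_ (by fun_prop)
    rw [contDiff_pi]
    intro i
    have h1 : ContDiff ℝ ∞ (fun q : ℝ × Total => Real.cos q.1) := Real.contDiff_cos.comp contDiff_fst
    have h2 : ContDiff ℝ ∞ (fun q : ℝ × Total => Real.sin q.1) := Real.contDiff_sin.comp contDiff_fst
    fin_cases i <;> simp [rigidMotion] <;> fun_prop
  · intro p
    refine Prod.ext (funext fun i => ?_) rfl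
    fin_cases i <;> simp [rigidMotion]
  · intro r s p
    refine Prod.ext (funext fun i => ?_) rfl
    fin_cases i <;> simp [rigidMotion, Real.cos_add, Real.sin_add] <;> ring
  · refine LocalOneParameterGroup.isSymmetryGroup_of_pointTransformation _ fun s =>
      ⟨Real.cos s, Real.sin s, 0, 1, fun _ => 0, Real.cos_sq_add_sin_sq s, contDiff_const,
        funext fun p => ?_⟩
    rw [viscoOp_zero]
    simp [globalGroup, pointTransformation]
  · funext p
    have hc : HasDerivAt Real.cos 0 0 := by simpa using Real.hasDerivAt_cos 0
    have hs : HasDerivAt Real.sin 1 0 := by simpa using Real.hasDerivAt_sin 0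
    have : HasDerivAt (fun s : ℝ => ((rigidMotion (Real.cos s) (Real.sin s) 0 p.1, p.2) : Total))
        (![p.1 1, -p.1 0, 0], 0) 0 := by
      refine HasDerivAt.prodMk (hasDerivAt_pi.2 fun i => ?_) (hasDerivAt_const _ _)
      fin_cases i
      · simpa [rigidMotion] using (hc.mul_const (p.1 0)).fun_add (hs.mul_const (p.1 1))
      · simpa [rigidMotion] using (hs.fun_neg.mul_const (p.1 0)).fun_add (hc.mul_const (p.1 1))
      · simpa [rigidMotion] using hasDerivAt_const (0 : ℝ) (p.1 2)
    exact this.deriv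

lemma exists_group_scaling (ε γ : ℝ) : ∃ Φ : LocalOneParameterGroup,
    Φ.dom = Set.univ ∧ Φ.IsSymmetryGroup ε γ ∧ Φ.generator = X₅ := by
  refine ⟨globalGroup (fun s p => (p.1, Real.exp s * p.2.1, Real.exp s * p.2.2)) (by fun_prop)
    (fun p => by simp) (fun r s p => by simp [Real.exp_add, mul_assoc]), rfl, ?_, ?_⟩
  · refine LocalOneParameterGroup.isSymmetryGroup_of_pointTransformation _ fun s =>
      ⟨1, 0, 0, Real.exp s, fun _ => 0, by norm_num, contDiff_const, funext fun p => ?_⟩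
    rw [viscoOp_zero]
    refine Prod.ext (funext fun i => ?_) (by simp [globalGroup, pointTransformation])
    fin_cases i <;> simp [globalGroup, pointTransformation, rigidMotion]
  · funext p
    have he : HasDerivAt Real.exp 1 0 := by simpa using Real.hasDerivAt_exp 0
    have : HasDerivAt (fun s : ℝ => ((p.1, Real.exp s * p.2.1, Real.exp s * p.2.2) : Total))
        (0, 1 * p.2.1, 1 * p.2.2) 0 :=
      (hasDerivAt_const _ _).prodMk ((he.mul_const _).prodMk (he.mul_const _))
    exact this.deriv.trans (by simp [X₅])

lemma exists_group_superposition (ε γ : ℝ) {α : Base → ℝ} (hα : ContDiff ℝ ∞ α) :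
    ∃ Φ : LocalOneParameterGroup,
      Φ.dom = Set.univ ∧ Φ.IsSymmetryGroup ε γ ∧ Φ.generator = Xα ε γ α := by
  refine ⟨globalGroup (fun s p => (p.1, p.2.1 + s * α p.1, p.2.2 + s * viscoOp ε γ α p.1))
    (by fun_prop) (fun p => by simp) (fun r s p => ?_), rfl, ?_, ?_⟩
  · simp only [Prod.mk.injEq, true_and]
    constructor <;> ring
  · refine LocalOneParameterGroup.isSymmetryGroup_of_pointTransformation _ fun s =>
      ⟨1, 0, 0, 1, fun z => s * α z, by norm_num, by fun_prop, funext fun p => ?_⟩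
    rw [viscoOp_const_mul _ _ _ hα]
    refine Prod.ext (funext fun i => ?_) (by simp [globalGroup, pointTransformation])
    fin_cases i <;> simp [globalGroup, pointTransformation, rigidMotion]
  · funext p
    have : HasDerivAt
        (fun s : ℝ => ((p.1, p.2.1 + s * α p.1, p.2.2 + s * viscoOp ε γ α p.1) : Total))
        (0, 1 * α p.1, 1 * viscoOp ε γ α p.1) 0 :=
      (hasDerivAt_const _ _).prodMk ((((hasDerivAt_id (0 : ℝ)).mul_const _).const_add _).prodMk
        (((hasDerivAt_id (0 : ℝ)).mul_const _).const_add _))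
    exact this.deriv.trans (by simp [Xα, verticalField])

lemma exists_group_X (ε γ : ℝ) (i : Fin 5) : ∃ Φ : LocalOneParameterGroup,
    Φ.dom = Set.univ ∧ Φ.IsSymmetryGroup ε γ ∧ Φ.generator = X i := by
  fin_cases i
  exacts [exists_group_translation ε γ _, exists_group_translation ε γ _,
    exists_group_translation ε γ _, exists_group_rotation ε γ, exists_group_scaling ε γ]

/-! ### Commutators -/

/-- The derivative of the generators `X₁, …, X₅`, which are affine vector fields. -/
noncomputable def derivX : Fin 5 → Total → Total :=
  ![0, 0, 0, fun v => (![v.1 1, -v.1 0, 0], 0, 0), fun v => (0, v.2.1, v.2.2)]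

lemma fderiv_X (i : Fin 5) (p v : Total) : fderiv ℝ (X i) p v = derivX i v := by
  have h4 : fderiv ℝ X₄ p v = (![v.1 1, -v.1 0, 0], 0, 0) := by
    let l : Total →ₗ[ℝ] Total :=
      { toFun := X₄
        map_add' := fun p q => by
          refine Prod.ext (funext fun i => ?_) (by simp [X₄])
          fin_cases i <;> simp [X₄]; ring
        map_smul' := fun c p => by
          refine Prod.ext (funext fun i => ?_) (by simp [X₄])
          fin_cases i <;> simp [X₄] }
    have : HasFDerivAt X₄ l.toContinuousLinearMap p := l.toContinuousLinearMap.hasFDerivAt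
    rw [this.fderiv]
    rfl
  have h5 : fderiv ℝ X₅ p v = (0, v.2.1, v.2.2) := by
    let l : Total →ₗ[ℝ] Total :=
      { toFun := X₅
        map_add' := fun p q => Prod.ext (by simp [X₅]) rfl
        map_smul' := fun c p => Prod.ext (by simp [X₅]) rfl }
    have : HasFDerivAt X₅ l.toContinuousLinearMap p := l.toContinuousLinearMap.hasFDerivAt
    rw [this.fderiv]
    rfl
  have h1 : fderiv ℝ X₁ p v = 0 := by unfold X₁; simp
  have h2 : fderiv ℝ X₂ p v = 0 := by unfold X₂; simp
  have h3 : fderiv ℝ X₃ p v = 0 := by unfold X₃; simp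
  fin_cases i
  exacts [h1, h2, h3, h4, h5]

lemma lieBracket_X (i j : Fin 5) :
    VectorField.lieBracket ℝ (X i) (X j) = commutatorTable i j := by
  funext p
  rw [VectorField.lieBracket, fderiv_X, fderiv_X]
  fin_cases i <;> fin_cases j <;>
    simp [derivX, X, X₁, X₂, X₃, X₄, X₅, commutatorTable, Prod.ext_iff]

/-! ### Generators of groups of point symmetries -/

/-- The inverse function theorem, with a smooth inverse on a whole neighbourhood. -/
lemma exists_smooth_localInverse {E : Type*} [NormedAddCommGroup E] [NormedSpace ℝ E]
    [FiniteDimensional ℝ E] {F : E → E} {D : Set E} (hD : IsOpen D) (hF : ContDiffOn ℝ ∞ F D)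
    {a : E} (ha : a ∈ D) (hinj : Function.Injective (fderiv ℝ F a)) :
    ∃ e : OpenPartialHomeomorph E E, a ∈ e.source ∧ e.source ⊆ D ∧ (∀ x, e x = F x) ∧
      ContDiffOn ℝ ∞ e.symm e.target := by
  have : CompleteSpace E := FiniteDimensional.complete ℝ E
  have hFat : ∀ x ∈ D, ContDiffAt ℝ ∞ F x := fun x hx => hF.contDiffAt (hD.mem_nhds hx)
  let A : E ≃L[ℝ] E :=
    (LinearEquiv.ofInjectiveEndo (fderiv ℝ F a : E →ₗ[ℝ] E) hinj).toContinuousLinearEquiv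
  have hA : (A : E →L[ℝ] E) = fderiv ℝ F a := by ext; rfl
  have hda : HasFDerivAt F (A : E →L[ℝ] E) a := by
    rw [hA]; exact ((hFat a ha).differentiableAt (by simp)).hasFDerivAt
  let e₀ := (hFat a ha).toOpenPartialHomeomorph F hda (by simp)
  -- Invertibility of the derivative is an open condition. Restricting to it makes the inverse
  -- smooth at every point of the target, not only at the image of `a`.
  let W : Set E := D ∩ fderiv ℝ F ⁻¹' Set.range ((↑) : (E ≃L[ℝ] E) → E →L[ℝ] E)
  have hW : IsOpen W :=
    (hF.continuousOn_fderiv_of_isOpen hD (by simp)).isOpen_inter_preimage hD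
      ContinuousLinearEquiv.isOpen
  have haW : a ∈ W := ⟨ha, A, hA⟩
  refine ⟨e₀.restrOpen W hW, ⟨(hFat a ha).mem_toOpenPartialHomeomorph_source hda (by simp), haW⟩,
    fun x hx => hx.2.1, fun x => rfl, fun y hy => ?_⟩
  set e := e₀.restrOpen W hW
  have hx : e.symm y ∈ W := (e.map_target hy).2
  obtain ⟨B, hB⟩ := hx.2
  refine (e.contDiffAt_symm hy (f₀' := B) ?_ (hFat _ hx.1)).contDiffWithinAt
  rw [hB]
  exact ((hFat _ hx.1).differentiableAt (by simp)).hasFDerivAt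

lemma LocalOneParameterGroup.hasDerivAt_map (Φ : LocalOneParameterGroup) (p : Total) :
    HasDerivAt (fun s => Φ.map s p)
      (fderiv ℝ (fun q : ℝ × Total => Φ.map q.1 q.2) (0, p) (1, 0)) 0 := by
  have h1 : HasDerivAt (fun s : ℝ => (s, p)) ((1 : ℝ), (0 : Total)) 0 :=
    (hasDerivAt_id _).prodMk (hasDerivAt_const _ _)
  have h2 := ((Φ.smooth.contDiffAt (Φ.isOpen_dom.mem_nhds (Φ.zero_mem p))).differentiableAt
    (by simp)).hasFDerivAt
  exact h2.comp_hasDerivAt (0 : ℝ) h1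

lemma LocalOneParameterGroup.contDiff_generator (Φ : LocalOneParameterGroup) :
    ContDiff ℝ ∞ Φ.generator := by
  have e : Φ.generator = fun p => fderiv ℝ (fun q : ℝ × Total => Φ.map q.1 q.2) (0, p) (1, 0) :=
    funext fun p => (Φ.hasDerivAt_map p).deriv
  rw [e, contDiff_iff_contDiffAt]
  intro p
  have h1 := (Φ.smooth.fderiv_of_isOpen Φ.isOpen_dom (m := ∞) (by simp)).contDiffAt
    (Φ.isOpen_dom.mem_nhds (Φ.zero_mem p))
  have h2 : ContDiffAt ℝ ∞ (fun p : Total => ((0 : ℝ), p)) p := by fun_prop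
  exact (h1.comp p h2).clm_apply contDiffAt_const

lemma LocalOneParameterGroup.hasDerivAt_generator (Φ : LocalOneParameterGroup) (p : Total) :
    HasDerivAt (fun s => Φ.map s p) (Φ.generator p) 0 :=
  (Φ.hasDerivAt_map p).differentiableAt.hasDerivAt

/-- The parameter derivative of a family of transformed functions is the characteristic. -/
lemma fderiv_transformed {R : ℝ × Base → ℝ} (hR : ContDiff ℝ ∞ R) {r : Base → ℝ} {w : Base}
    {H : ℝ → Total} {v : Total} (hH : HasDerivAt H v 0) (hH0 : (H 0).1 = w) (l : Total →L[ℝ] ℝ)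
    (h1 : ∀ᶠ s in 𝓝 0, R (s, (H s).1) = l (H s)) (h2 : (fun z => R (0, z)) =ᶠ[𝓝 w] r) :
    fderiv ℝ R (0, w) (1, 0) = l v - ∑ i, v.1 i * pd i r w := by
  have hd : HasFDerivAt R (fderiv ℝ R (0, w)) (0, (H 0).1) := by
    rw [hH0]; exact (differentiable_of_smooth hR _).hasFDerivAt
  have hH1 : HasDerivAt (fun s => (H s).1) v.1 0 :=
    (ContinuousLinearMap.fst ℝ Base (ℝ × ℝ)).hasFDerivAt.comp_hasDerivAt (0 : ℝ) hH
  have hpair : HasDerivAt (fun s : ℝ => (s, (H s).1)) ((1 : ℝ), v.1) 0 :=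
    (hasDerivAt_id _).prodMk hH1
  -- Following the moving point gives the derivative in direction `(1, v.1)`; subtracting its
  -- spatial part leaves the derivative at fixed base point.
  have ha : HasDerivAt (fun s => R (s, (H s).1)) (fderiv ℝ R (0, w) (1, v.1)) 0 :=
    hd.comp_hasDerivAt (0 : ℝ) hpair
  have hb : HasDerivAt (fun s => l (H s)) (l v) 0 := l.hasFDerivAt.comp_hasDerivAt (0 : ℝ) hH
  have e1 : fderiv ℝ R (0, w) (1, v.1) = l v := ha.unique (hb.congr_of_eventuallyEq h1)
  have e2 : fderiv ℝ R (0, w) (0, v.1) = ∑ i, v.1 i * pd i r w := by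
    rw [← fderiv_slice (differentiable_of_smooth hR), h2.fderiv_eq, fderiv_eq_sum_pd]
  have e3 : ((1, 0) : ℝ × Base) = (1, v.1) - (0, v.1) := by simp
  rw [e3, map_sub, e1, e2]

/-- The group moves the graph of `(u, L u)` to graphs of a smooth family `(U_s, G_s)` with `L U_s =
G_s`. Differentiating at `s = 0` gives `L Q = φ₂ - ξ·∇f`, where `Q` is the characteristic. -/
lemma LocalOneParameterGroup.IsSymmetryGroup.isInvariantAlongSolutions
    {Φ : LocalOneParameterGroup} {ε γ : ℝ} (hΦ : Φ.IsSymmetryGroup ε γ) :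
    IsInvariantAlongSolutions ε γ Φ.generator := by
  intro u hu z₀
  set f := viscoOp ε γ u with hfdef
  have hf : ContDiff ℝ ∞ f := contDiff_viscoOp ε γ hu
  let M : ℝ × Base → ℝ × Total := fun q => (q.1, q.2, u q.2, f q.2)
  have hM : ContDiff ℝ ∞ M := by simp only [M]; fun_prop
  let D : Set (ℝ × Base) := M ⁻¹' Φ.dom
  have hD : IsOpen D := Φ.isOpen_dom.preimage hM.continuous
  have hD0 : ∀ z, (0, z) ∈ D := fun z => Φ.zero_mem _
  let H : ℝ × Base → Total := fun q => Φ.map q.1 (q.2, u q.2, f q.2)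
  have hH : ContDiffOn ℝ ∞ H D := Φ.smooth.comp hM.contDiffOn fun q hq => hq
  have hH0 : ∀ z, H (0, z) = (z, u z, f z) := fun z => Φ.map_zero _
  have hH1 : ContDiffOn ℝ ∞ (fun q => (H q).1) D := hH.fst
  -- Keeping `s` as a coordinate, one inversion serves all small parameters and makes the
  -- transformed functions jointly smooth in `(s, w)`.
  let F : ℝ × Base → ℝ × Base := fun q => (q.1, (H q).1)
  have hF : ContDiffOn ℝ ∞ F D := contDiffOn_fst.prodMk hH1
  have hinj : Function.Injective (fderiv ℝ F (0, z₀)) := by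
    have hL : HasFDerivAt (fun q => (H q).1) (fderiv ℝ (fun q => (H q).1) (0, z₀)) (0, z₀) :=
      ((hH1.contDiffAt (hD.mem_nhds (hD0 z₀))).differentiableAt (by simp)).hasFDerivAt
    have hFd : HasFDerivAt F ((ContinuousLinearMap.fst ℝ ℝ Base).prod
        (fderiv ℝ (fun q => (H q).1) (0, z₀))) (0, z₀) := hasFDerivAt_fst.prodMk hL
    have hslice : HasFDerivAt (fun z : Base => z)
        ((fderiv ℝ (fun q => (H q).1) (0, z₀)).comp (ContinuousLinearMap.inr ℝ ℝ Base)) z₀ := by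
      have h1 : HasFDerivAt (fun w : Base => ((0 : ℝ), w)) (ContinuousLinearMap.inr ℝ ℝ Base) z₀ :=
        hasFDerivAt_prodMk_right 0 z₀
      have h2 : HasFDerivAt (fun z : Base => (H (0, z)).1) _ z₀ := hL.comp z₀ h1
      simpa only [hH0] using h2
    -- At `s = 0` the base point does not move, so the derivative of `F` is block triangular with
    -- identity diagonal blocks.
    have hid := hslice.unique (hasFDerivAt_id z₀)
    rw [hFd.fderiv, injective_iff_map_eq_zero]
    rintro ⟨σ, v⟩ hv
    obtain ⟨h1, h2⟩ := Prod.mk.inj hv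
    have h3 : σ = 0 := h1
    subst h3
    have h4 : v = 0 := by
      have := DFunLike.congr_fun hid v
      exact this.symm.trans h2
    rw [h4]
    rfl
  obtain ⟨e, hse, heD, heF, hes⟩ := exists_smooth_localInverse hD hF (hD0 z₀) hinj
  have hsymm : ∀ q ∈ e.target, (e.symm q).1 = q.1 ∧ (H (e.symm q)).1 = q.2 := fun q hq => by
    have := e.right_inv hq
    rw [heF] at this
    have h1 : (F (e.symm q)).1 = q.1 := by rw [this]
    have h2 : (F (e.symm q)).2 = q.2 := by rw [this]
    exact ⟨h1, h2⟩
  have hleft : ∀ q ∈ e.source, e.symm (q.1, (H q).1) = q := fun q hq => by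
    have := e.left_inv hq
    rwa [heF] at this
  have hmem : ∀ q ∈ e.source, (q.1, (H q).1) ∈ e.target := fun q hq => by
    have := e.map_source hq
    rwa [heF] at this
  -- `K (s, w)` is the point of the transformed graph lying over `w`.
  let K : ℝ × Base → Total := fun q => H (e.symm q)
  have hK : ContDiffOn ℝ ∞ K e.target := hH.comp hes fun q hq => heD (e.map_target hq)
  have ht : (0, z₀) ∈ e.target := by simpa [hH0] using hmem _ hse
  -- the transformed functions are solutions
  have hsol : ∀ q ∈ e.target, viscoOp ε γ (fun w => (K (q.1, w)).2.1) q.2 = (K q).2.2 := by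
    rintro ⟨s, w₀⟩ hq
    have hcont : Continuous (fun w : Base => (s, w)) := by fun_prop
    have hmaps : Set.MapsTo (fun w : Base => (s, w)) ((fun w => (s, w)) ⁻¹' e.target) e.target :=
      fun w hw => hw
    have hKs : ContDiffOn ℝ ∞ (fun w => K (s, w)) ((fun w => (s, w)) ⁻¹' e.target) :=
      hK.comp (contDiff_const.prodMk contDiff_id).contDiffOn hmaps
    refine (hΦ s ((fun w => (s, w)) ⁻¹' e.source) ((fun w => (s, w)) ⁻¹' e.target) u f
      (fun w => (K (s, w)).2.1) (fun w => (K (s, w)).2.2) (e.open_source.preimage hcont)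
      (e.open_target.preimage hcont) ⟨hu.contDiffOn, hf.contDiffOn, fun z _ => rfl⟩
      (fun z hz => heD hz) hKs.snd.fst hKs.snd.snd ?_).2.2 w₀ hq
    ext p
    constructor
    · rintro ⟨_, ⟨z, hz, rfl⟩, rfl⟩
      refine ⟨(H (s, z)).1, hmem _ hz, ?_⟩
      have := hleft _ hz
      simp only [K]
      simp only at this
      rw [this]
    · rintro ⟨w, hw, rfl⟩
      obtain ⟨h1, h2⟩ := hsymm _ hw
      have h3 : e.symm (s, w) = (s, (e.symm (s, w)).2) := Prod.ext h1 rfl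
      refine ⟨_, ⟨(e.symm (s, w)).2, ?_, rfl⟩, ?_⟩
      · change (s, (e.symm (s, w)).2) ∈ e.source
        rw [← h3]; exact e.map_target hw
      · change H (s, (e.symm (s, w)).2) = _
        rw [← h3]
        exact Prod.ext h2 rfl
  -- smooth extensions of the two components
  obtain ⟨U, hU, hUK⟩ := exists_contDiff_eventuallyEq e.open_target hK.snd.fst ht
  obtain ⟨G, hG, hGK⟩ := exists_contDiff_eventuallyEq e.open_target hK.snd.snd ht
  have cs : ∀ w : Base, Tendsto (fun s : ℝ => (s, w)) (𝓝 0) (𝓝 (0, w)) := fun w =>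
    (by fun_prop : Continuous (fun s : ℝ => (s, w))).tendsto 0
  have cw : ∀ (s : ℝ) (w : Base), Tendsto (fun w : Base => (s, w)) (𝓝 w) (𝓝 (s, w)) := fun s w =>
    (by fun_prop : Continuous (fun w : Base => (s, w))).tendsto w
  have heq : ∀ᶠ s in 𝓝 (0 : ℝ), viscoOp ε γ (fun w => U (s, w)) z₀ = G (s, z₀) := by
    filter_upwards [(cs z₀).eventually hUK.eventually_nhds, (cs z₀).eventually hGK,
      (cs z₀).eventually (e.open_target.mem_nhds ht)] with s h1 h2 h3
    rw [h2, ← hsol _ h3]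
    exact (viscoOp_congr ε γ ((cw s z₀).eventually h1)).eq_of_nhds
  -- Both sides are the derivative at `s = 0` of the same function of `s`, by `heq`.
  have hlin : viscoOp ε γ (fun w => fderiv ℝ U (0, w) (1, 0)) z₀ = fderiv ℝ G (0, z₀) (1, 0) :=
    (hasDerivAt_viscoOp_slice ε γ hU z₀).unique
      ((hasDerivAt_slice hG 0 z₀).congr_of_eventuallyEq heq)
  have hder : ∀ (R : ℝ × Base → ℝ), ContDiff ℝ ∞ R → ∀ (l : Total →L[ℝ] ℝ) (w : Base),
      (0, w) ∈ e.source → (∀ᶠ q in 𝓝 (0, w), R q = l (K q)) →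
      fderiv ℝ R (0, w) (1, 0) = l (Φ.generator (w, u w, f w))
        - ∑ i, (Φ.generator (w, u w, f w)).1 i * pd i (fun z => l (z, u z, f z)) w := by
    intro R hR l w hw hRK
    have hFc : Tendsto F (𝓝 (0, w)) (𝓝 (0, w)) := by
      have := (hF.contDiffAt (hD.mem_nhds (hD0 w))).continuousAt
      simpa [ContinuousAt, F, hH0] using this
    have hRF : ∀ᶠ q in 𝓝 (0, w), R (q.1, (H q).1) = l (H q) := by
      filter_upwards [hFc.eventually hRK, e.open_source.mem_nhds hw] with q h1 h2
      have h3 : R (q.1, (H q).1) = l (K (q.1, (H q).1)) := h1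
      rw [h3]
      simp only [K]
      rw [hleft q h2]
    refine fderiv_transformed hR (Φ.hasDerivAt_generator (w, u w, f w))
      (by rw [Φ.map_zero]) l ((cs w).eventually hRF) ?_
    filter_upwards [(cw 0 w).eventually hRF] with z hz
    simpa [hH0] using hz
  -- Equality is needed on a neighbourhood of `z₀`, since `L` is applied to it; for the `f`
  -- component the value at `z₀` suffices.
  have hQ : (fun w => fderiv ℝ U (0, w) (1, 0)) =ᶠ[𝓝 z₀] characteristicU Φ.generator u f := by
    filter_upwards [(cw 0 z₀).eventually hUK.eventually_nhds,
      (cw 0 z₀).eventually (e.open_source.mem_nhds hse)] with w h1 h2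
    exact hder U hU ((ContinuousLinearMap.fst ℝ ℝ ℝ).comp
      (ContinuousLinearMap.snd ℝ Base (ℝ × ℝ))) w h2 h1
  have hψ := hder G hG ((ContinuousLinearMap.snd ℝ ℝ ℝ).comp
      (ContinuousLinearMap.snd ℝ Base (ℝ × ℝ))) z₀ hse hGK
  rw [(viscoOp_congr ε γ hQ).eq_of_nhds, hψ] at hlin
  rw [hlin]
  simp

end Viscoelastic

open Viscoelastic

theorem mainTheorem2 (ε γ : ℝ) (hε : ε ≠ 0) (hγ : γ ≠ 0) :
    -- the infinitesimal symmetries are exactly the combinations of the listed vector fields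
    (∀ V : Total → Total, ContDiff ℝ ∞ V →
      (IsInfinitesimalSymmetry ε γ V ↔
        ∃ (c : Fin 5 → ℝ) (α : Base → ℝ), ContDiff ℝ ∞ α ∧ V = ∑ i, c i • X i + Xα ε γ α)) ∧
    -- every local one-parameter group of point symmetries is generated by such a combination
    (∀ Φ : LocalOneParameterGroup, Φ.IsSymmetryGroup ε γ →
      ∃ (c : Fin 5 → ℝ) (α : Base → ℝ), ContDiff ℝ ∞ α ∧
        Φ.generator = ∑ i, c i • X i + Xα ε γ α) ∧
    -- each listed vector field generates a global one-parameter group of point symmetries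
    (∀ i : Fin 5, ∃ Φ : LocalOneParameterGroup,
      Φ.dom = Set.univ ∧ Φ.IsSymmetryGroup ε γ ∧ Φ.generator = X i) ∧
    (∀ α : Base → ℝ, ContDiff ℝ ∞ α → ∃ Φ : LocalOneParameterGroup,
      Φ.dom = Set.univ ∧ Φ.IsSymmetryGroup ε γ ∧ Φ.generator = Xα ε γ α) ∧
    -- `α ∂_u` itself is a symmetry exactly if `α` solves the homogeneous equation
    (∀ α : Base → ℝ, ContDiff ℝ ∞ α →
      (IsInfinitesimalSymmetry ε γ (verticalField α 0) ↔ ∀ z, viscoOp ε γ α z = 0)) ∧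
    -- the commutators
    (∀ i j : Fin 5, VectorField.lieBracket ℝ (X i) (X j) = commutatorTable i j) := by
  refine ⟨fun V hV => ⟨fun h => (h.isInvariantAlongSolutions hV).exists_eq hε hγ hV, ?_⟩,
    fun Φ hΦ => hΦ.isInvariantAlongSolutions.exists_eq hε hγ Φ.contDiff_generator,
    exists_group_X ε γ, fun α hα => exists_group_superposition ε γ hα,
    fun α hα => isInfinitesimalSymmetry_verticalField_iff ε γ hα, lieBracket_X⟩
  rintro ⟨c, α, hα, h⟩
  exact isInfinitesimalSymmetry_combination ε γ c hα hV h
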